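/- Let $A$ be an $l\times l$ matrix of zeroes and ones with $A^d>0$ for some $d\ge 1$, let $\Sigma=\{(x_n)_{n\ge 0}: A(x_n,x_{n+1})=1 \text{ for all } n\}$ with the product topology, and let $\sigma$ be the left shift. Write $[x]_m=\{y\in\Sigma: y_i=x_i,\ 0\le i<m\}$, and $[x]_m=[x_0x_1\cdots x_{m-1}]$. For $\theta\in(0,1)$ let $d_\theta(x,y)=\theta^m$, where $m$ is the first index with $x_m\ne y_m$, and $d_\theta(x,x)=0$. Let $\phi:\Sigma\to\mathbb R$ be $d_\theta$-Lipschitz. For $K\subseteq\Sigma$ measurable let $$P_K(\phi)=\sup\Big\{h_\nu(\sigma)+\int\phi\,d\nu\;:\;\nu \text{ a }\sigma\text{-invariant Borel probability measure},\ \nu(K)=1\Big\},\qquad P(\phi)=P_\Sigma(\phi),$$ where $h_\nu$ is the Kolmogorov--Sinai entropy, and let $\mu$ be an equilibrium state of $\phi$, i.e. an invariant Borel probability measure with $h_\mu+\int\phi\,d\mu=P(\phi)$. Let $\mathcal B_\theta$ be the space of $w\in L^1(\mu)$ (complex valued) with $\sup_{m\ge1}\theta^{-m}\int \mathrm{osc}(w,m,x)\,d\mu(x)<\infty$,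 where $\mathrm{osc}(w,m,x)=\operatorname{esssup}\{|w(y)-w(y')|:y,y'\in[x]_m\}$. Let $(\mathcal L w)(x)=\sum_{\sigma(y)=x}e^{\phi(y)}w(y)$. Let $z\in\Sigma$ and let $U_n$ $(n\ge1)$ be open sets such that: 1. $U_{n+1}\subseteq U_n$ for all $n\ge 1$ and $\bigcap_{n\ge1}U_n=\{z\}$; 2. each $U_n$ is a finite union of cylinders of length $n$; 3. there are $c>0$ and $0<\rho<1$ with $\mu(U_n)\le c\rho^n$ for all $n\ge1$; 4. there are $l_n\in\mathbb N$ and $\kappa>0$ with $\kappa<l_n/n\le1$ and $U_n\subseteq[z]_{l_n}$ for all $n\ge1$; 5. if $z$ is periodic with prime period $p$, then $\sigma^{-p}(U_n)\cap[z_0z_1\cdots z_{p-1}]\subseteq U_n$ for all large $n$. Let $\mathcal L_n w=\mathcal L(\chi_{U_n^c}w)$ be the punctured operators and $\Sigma_n=\bigcap_{k\ge0}\Sigma\setminus\sigma^{-k}(U_n)$ the survivor sets. By the leading eigenvalue of an operator on $\mathcal B_\theta$ we mean a positive eigenvalue $r$ such that $|\eta|\le r$ for every eigenvalue $\eta\in\mathbb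 C$ of that operator on $\mathcal B_\theta$. Then $\mathcal L$ has a leading eigenvalue $\lambda$ on $\mathcal B_\theta$, for all large $n$ the operator $\mathcal L_n$ has a leading eigenvalue $\lambda_n$ on $\mathcal B_\theta$, and $$\lim_{n\to\infty}\lambda_n=\lambda .$$ Moreover $P(\phi)=\log\lambda$ and $P_{\Sigma_n}(\phi)=\log\lambda_n$ for all large $n$; equivalently, therefore, $\lim_{n\to\infty}P_{\Sigma_n}(\phi)=P(\phi)$. -/

import Mathlib

open Filter Topology MeasureTheory Set

noncomputable section

namespace EscapeRate

/-- The one-sided subshift of finite type of the matrix `A`, with the (subspace of the)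
product topology and the product (i.e. Borel) sigma-algebra. -/
abbrev Subshift {l : ℕ} (A : Matrix (Fin l) (Fin l) ℕ) : Type :=
  {x : ℕ → Fin l // ∀ n, A (x n) (x (n + 1)) = 1}

section Dynamics

variable {l : ℕ} {A : Matrix (Fin l) (Fin l) ℕ}

/-- The left shift. -/
def shift (x : Subshift A) : Subshift A :=
  ⟨fun n => x.1 (n + 1), fun n => x.2 (n + 1)⟩

/-- The cylinder `[x]_m`: all `y` with `y_i = x_i` for `0 ≤ i < m`. -/
def cylinder (x : Subshift A) (m : ℕ) : Set (Subshift A) :=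
  {y | ∀ i < m, y.1 i = x.1 i}

/-- The metric `d_θ(x, y) = θ ^ m`, where `m` is the first index at which `x` and `y` differ. -/
def dTheta (θ : ℝ) (x y : Subshift A) : ℝ :=
  open Classical in if x = y then 0 else θ ^ PiNat.firstDiff x.1 y.1

/-- `d_θ`-Lipschitz real functions. -/
def IsThetaLipschitz (θ : ℝ) (φ : Subshift A → ℝ) : Prop :=
  ∃ C : ℝ, ∀ x y, |φ x - φ y| ≤ C * dTheta θ x y

/-- The survivor set of the hole `V`: points whose forward orbit never meets `V`. -/
def survivor (V : Set (Subshift A)) : Set (Subshift A) :=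
  ⋂ k : ℕ, ((shift)^[k] ⁻¹' V)ᶜ

end Dynamics

section Entropy

variable {X : Type*} [MeasurableSpace X]

/-- Shannon entropy of the finite partition of `X` into the fibres of `f`. -/
def partitionEntropy {ι : Type*} [Fintype ι] (μ : Measure X) (f : X → ι) : ℝ :=
  ∑ a, Real.negMulLog (μ.real (f ⁻¹' {a}))

/-- Entropy of `T` relative to the partition `ξ`: the limit of `H(⋁_{i<n} T⁻ⁱ ξ) / n`
(the limit exists by subadditivity when `μ` is `T`-invariant). -/
def entropyRel {k : ℕ} (μ : Measure X) (T : X → X) (ξ : X → Fin k) : EReal :=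
  limsup (fun n : ℕ =>
    ((partitionEntropy μ (fun x => fun i : Fin n => ξ (T^[i] x)) / n : ℝ) : EReal)) atTop

/-- Kolmogorov-Sinai entropy: supremum over finite measurable partitions. -/
def ksEntropy (μ : Measure X) (T : X → X) : EReal :=
  ⨆ (k : ℕ) (ξ : X → Fin k) (_ : Measurable ξ), entropyRel μ T ξ

end Entropy

section Thermodynamics

variable {l : ℕ} {A : Matrix (Fin l) (Fin l) ℕ}

/-- Pressure of `φ` on `K`: supremum of `h_ν + ∫ φ dν` over shift-invariant Borel probability
measures `ν` with `ν K = 1`. -/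
def pressure (φ : Subshift A → ℝ) (K : Set (Subshift A)) : EReal :=
  ⨆ (ν : Measure (Subshift A)) (_ : IsProbabilityMeasure ν)
    (_ : MeasurePreserving shift ν ν) (_ : ν K = 1),
    ksEntropy ν shift + ((∫ x, φ x ∂ν : ℝ) : EReal)

/-- `μ` is an equilibrium state of `φ`. -/
structure IsEquilibriumState (φ : Subshift A → ℝ) (μ : Measure (Subshift A)) : Prop where
  prob : IsProbabilityMeasure μ
  invariant : MeasurePreserving shift μ μ
  attains : ksEntropy μ shift + ((∫ x, φ x ∂μ : ℝ) : EReal) = pressure φ univ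

/-- Every point has finitely many preimages, so the sum in `transfer` is finite. -/
theorem finite_fibre (x : Subshift A) : {y : Subshift A | shift y = x}.Finite := by
  refine Set.Finite.of_finite_image (f := fun y : Subshift A => y.1 0) (Set.toFinite _) ?_
  intro y hy y' hy' h
  have hs : shift y = shift y' := (show shift y = x from hy).trans (show shift y' = x from hy').symm
  apply Subtype.ext
  funext n
  cases n with
  | zero => exact h
  | succ n => exact congrFun (congrArg Subtype.val hs) n

/-- The transfer operator `(L w)(x) = ∑_{σ y = x} e^{φ(y)} w(y)`. -/
def transfer (φ : Subshift A → ℝ) (w : Subshift A → ℂ) (x : Subshift A) : ℂ :=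
  ∑ y ∈ (finite_fibre x).toFinset, (Real.exp (φ y) : ℂ) * w y

/-- The punctured operator `w ↦ L (χ_{Vᶜ} w)`. -/
def punctured (φ : Subshift A → ℝ) (V : Set (Subshift A)) (w : Subshift A → ℂ) :
    Subshift A → ℂ :=
  transfer φ (Vᶜ.indicator w)

/-- `osc(w, m, x)`: essential supremum of `|w(y) - w(z)|` over `y, z ∈ [x]_m`. -/
def osc (μ : Measure (Subshift A)) (w : Subshift A → ℂ) (m : ℕ) (x : Subshift A) : ENNReal :=
  essSup (fun p : Subshift A × Subshift A => ‖w p.1 - w p.2‖ₑ)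
    ((μ.restrict (cylinder x m)).prod (μ.restrict (cylinder x m)))

/-- The seminorm `|w|_θ = sup_{m ≥ 1} θ^{-m} ‖osc(w, m, ·)‖₁`. -/
def oscSeminorm (θ : ℝ) (μ : Measure (Subshift A)) (w : Subshift A → ℂ) : ENNReal :=
  ⨆ (m : ℕ) (_ : 1 ≤ m), ENNReal.ofReal ((θ ^ m)⁻¹) * ∫⁻ x, osc μ w m x ∂μ

/-- Membership in the space `B_θ` of integrable functions with finite seminorm `|·|_θ`. -/
def MemB (θ : ℝ) (μ : Measure (Subshift A)) (w : Subshift A → ℂ) : Prop :=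
  Integrable w μ ∧ oscSeminorm θ μ w < ⊤

/-- `η` is an eigenvalue of `T` acting on `B_θ` (functions are identified `μ`-a.e.). -/
def IsEigenvalueB (θ : ℝ) (μ : Measure (Subshift A))
    (T : (Subshift A → ℂ) → Subshift A → ℂ) (η : ℂ) : Prop :=
  ∃ w, MemB θ μ w ∧ ¬ (w =ᵐ[μ] 0) ∧ T w =ᵐ[μ] fun x => η * w x

/-- `r` is the leading eigenvalue of `T` on `B_θ`: a positive eigenvalue, maximal in modulus. -/
def IsLeadingEigenvalue (θ : ℝ) (μ : Measure (Subshift A))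
    (T : (Subshift A → ℂ) → Subshift A → ℂ) (r : ℝ) : Prop :=
  0 < r ∧ IsEigenvalueB θ μ T (r : ℂ) ∧ ∀ η : ℂ, IsEigenvalueB θ μ T η → ‖η‖ ≤ r

/-- The standing assumptions on the holes `U_n`, `n ≥ 1`, shrinking to `z`
(the value `U 0` plays no role). -/
structure IsHoleFamily (μ : Measure (Subshift A)) (z : Subshift A)
    (U : ℕ → Set (Subshift A)) : Prop where
  isOpen : ∀ n, 1 ≤ n → IsOpen (U n)
  nested : ∀ n, 1 ≤ n → U (n + 1) ⊆ U n
  inter_eq : ⋂ (n : ℕ) (_ : 1 ≤ n), U n = {z}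
  cylinders : ∀ n, 1 ≤ n → ∃ F : Finset (Subshift A), U n = ⋃ x ∈ F, cylinder x n
  measure_le : ∃ c ρ : ℝ, 0 < c ∧ 0 < ρ ∧ ρ < 1 ∧ ∀ n, 1 ≤ n → μ.real (U n) ≤ c * ρ ^ n
  subset_cylinder : ∃ (L : ℕ → ℕ) (κ : ℝ), 0 < κ ∧ ∀ n : ℕ, 1 ≤ n →
    κ < (L n : ℝ) / n ∧ (L n : ℝ) / n ≤ 1 ∧ U n ⊆ cylinder z (L n)
  periodic : ∀ p : ℕ, 0 < p → Function.minimalPeriod shift z = p →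
    ∀ᶠ n in atTop, (shift)^[p] ⁻¹' (U n) ∩ cylinder z p ⊆ U n

end Thermodynamics

end EscapeRate

end

noncomputable section

namespace EscapeRate

/-! ### Symbolic coding, inverse branches and the weighted transfer operator -/

section Operator

variable {l : ℕ} {A : Matrix (Fin l) (Fin l) ℕ}

/-! For a hole `V` that depends on finitely many coordinates, let `G` be `exp φ` set to zero on `V`.
Everything is expressed through one number, `radius G`, the exponential growth rate of the iterates
of the transfer operator `op G` on the constant 1. Three facts about it give the theorem.

It is a leading eigenvalue. As `s` decreases to the radius, the resolvents applied to 1 lie in a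
cone of log-Hölder functions preserved by the operator; normalised, they accumulate at an
eigenfunction (`exists_eigenfunction`). Conversely an eigenfunction `w` in `B_θ` is essentially
bounded, so iterating `|η| |w| ≤ op G |w|` gives `|η| ≤ radius G` (`norm_eigenvalue_le`). Since
functions are identified almost everywhere, this needs `μ` to have full support and almost every
point to have no preimage in a given null set. Both follow from invariance of `μ` under the operator
normalised by its eigenfunction, which is the first-order condition at the maximum of the pressure
functional (`integral_eq_integral_op`).

Its logarithm is the pressure of the survivor set (`pressure_survivor_eq`). The upper bound compares
itinerary probabilities with weights built from the operator, through the Gibbs inequality. The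
lower bound is attained by an invariant measure with a Gibbs estimate, built from the eigenfunction.

It is continuous as the hole shrinks. Closing the hole can only increase it. From below, a visit to
`[z]_{2N}` forces, at the next multiple of `N`, one of the `N` blocks of length `N` that start in
`z` below position `N`. Each such cylinder contributes to the `N`-th iterate an exponentially
smaller amount than `λ^N`, so forbidding all of them at multiples of `N` costs at most half the
mass. Thus the radius is at least `λ / 2^(1/N)` as soon as the hole lies in `[z]_{2N}`, with no
perturbation theory of operators (`half_pow_le_radius_pow`). -/

instance : CompactSpace (Subshift A) := by
  have : IsClosed {x : ℕ → Fin l | ∀ n, A (x n) (x (n + 1)) = 1} := by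
    rw [Set.ofPred_forall]
    refine isClosed_iInter fun n => ?_
    have h : Continuous fun x : ℕ → Fin l => A (x n) (x (n + 1)) :=
      Continuous.comp (g := fun p : Fin l × Fin l => A p.1 p.2) continuous_of_discreteTopology
        (f := fun x : ℕ → Fin l => (x n, x (n + 1)))
        ((continuous_apply n).prodMk (continuous_apply (n + 1)))
    exact isClosed_singleton.preimage h
  exact isCompact_iff_compactSpace.mp this.isCompact

instance : TopologicalSpace.MetrizableSpace (Subshift A) :=
  Topology.IsEmbedding.subtypeVal.metrizableSpace

instance : SecondCountableTopology (Subshift A) :=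
  Topology.IsEmbedding.subtypeVal.secondCountableTopology

theorem continuous_coord (i : ℕ) : Continuous fun x : Subshift A => x.1 i :=
  (continuous_apply i).comp continuous_subtype_val

theorem continuous_comp_coord {M : Type*} [TopologicalSpace M] (F : Fin l → M) (i : ℕ) :
    Continuous fun x : Subshift A => F (x.1 i) :=
  Continuous.comp (g := F) continuous_of_discreteTopology (continuous_coord i)

/-- The points `x` and `y` have the same first `m` coordinates. -/
def Agree (m : ℕ) (x y : Subshift A) : Prop := ∀ i < m, x.1 i = y.1 i

theorem Agree.symm {m : ℕ} {x y : Subshift A} (h : Agree m x y) : Agree m y x :=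
  fun i hi => (h i hi).symm

theorem Agree.trans {m : ℕ} {x y z : Subshift A} (h : Agree m x y) (h' : Agree m y z) :
    Agree m x z := fun i hi => (h i hi).trans (h' i hi)

theorem Agree.mono {m n : ℕ} {x y : Subshift A} (h : Agree m x y) (hn : n ≤ m) : Agree n x y :=
  fun i hi => h i (hi.trans_le hn)

theorem Agree.refl (m : ℕ) (x : Subshift A) : Agree m x x := fun _ _ => rfl

theorem mem_cylinder {m : ℕ} {x y : Subshift A} : y ∈ cylinder x m ↔ Agree m y x := Iff.rfl

theorem continuous_shift : Continuous (shift : Subshift A → Subshift A) :=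
  continuous_induced_rng.2 (continuous_pi fun n => continuous_coord (n + 1))

theorem shift_iterate_apply (n i : ℕ) (x : Subshift A) : (shift^[n] x).1 i = x.1 (i + n) := by
  induction n generalizing i with
  | zero => rfl
  | succ n ih =>
    rw [Function.iterate_succ_apply']
    change (shift^[n] x).1 (i + 1) = _
    rw [ih, add_right_comm, add_assoc]

theorem Agree.shift_iterate {m n : ℕ} {x y : Subshift A} (h : Agree (m + n) x y) :
    Agree m (shift^[n] x) (shift^[n] y) := by
  intro i hi
  rw [shift_iterate_apply, shift_iterate_apply]
  exact h _ (by omega)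

theorem isOpen_cylinder (x : Subshift A) (m : ℕ) : IsOpen (cylinder x m) := by
  have : cylinder x m = ⋂ i ∈ Finset.range m, (fun y : Subshift A => y.1 i) ⁻¹' {x.1 i} := by
    ext y; simp [cylinder]
  rw [this]
  refine isOpen_biInter_finset fun i _ => (isOpen_discrete _).preimage ?_
  exact (continuous_apply i).comp continuous_subtype_val

/-- A set that depends on the first `q` coordinates only. -/
def DependsOn (q : ℕ) (V : Set (Subshift A)) : Prop := ∀ x y, Agree q x y → x ∈ V → y ∈ V

theorem DependsOn.isOpen {q : ℕ} {V : Set (Subshift A)} (h : DependsOn q V) : IsOpen V := by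
  rw [isOpen_iff_mem_nhds]
  intro x hx
  filter_upwards [(isOpen_cylinder x q).mem_nhds (Agree.refl q x)] with y hy
  exact h x y (Agree.symm hy) hx

theorem DependsOn.compl {q : ℕ} {V : Set (Subshift A)} (h : DependsOn q V) : DependsOn q Vᶜ :=
  fun x y hxy hx hy => hx (h y x hxy.symm hy)

theorem DependsOn.isClopen {q : ℕ} {V : Set (Subshift A)} (h : DependsOn q V) : IsClopen V :=
  ⟨⟨h.compl.isOpen⟩, h.isOpen⟩

theorem dependsOn_cylinder (x : Subshift A) (m : ℕ) : DependsOn m (cylinder x m) :=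
  fun _ _ h hy =>
  Agree.trans h.symm (mem_cylinder.1 hy)

theorem dependsOn_empty (q : ℕ) : DependsOn q (∅ : Set (Subshift A)) := fun _ _ _ h => h

/-- The preimage of `x` under the shift with first symbol `a`, when there is one. -/
def pre (a : Fin l) (x : Subshift A) : Subshift A :=
  if h : A a (x.1 0) = 1 then
    ⟨fun n => Nat.casesOn n a x.1, fun n => by cases n with
      | zero => exact h
      | succ n => exact x.2 n⟩
  -- The value `x` when the branch does not exist makes `pre a` total and continuous; operator sums
  -- discard it by the admissibility test.
  else x

theorem pre_zero {a : Fin l} {x : Subshift A} (h : A a (x.1 0) = 1) : (pre a x).1 0 = a := by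
  simp [pre, h]

theorem pre_succ {a : Fin l} {x : Subshift A} (h : A a (x.1 0) = 1) (n : ℕ) :
    (pre a x).1 (n + 1) = x.1 n := by
  simp [pre, h]

theorem shift_pre {a : Fin l} {x : Subshift A} (h : A a (x.1 0) = 1) : shift (pre a x) = x :=
  Subtype.ext (funext fun n => pre_succ h n)

theorem shift_allowed (y : Subshift A) : A (y.1 0) ((shift y).1 0) = 1 := y.2 0

theorem pre_shift (y : Subshift A) : pre (y.1 0) (shift y) = y := by
  apply Subtype.ext
  funext n
  cases n with
  | zero => exact pre_zero (shift_allowed y)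
  | succ n => exact pre_succ (shift_allowed y) n

theorem Agree.pre {m : ℕ} {a : Fin l} {x y : Subshift A} (h : Agree m x y)
    (hx : A a (x.1 0) = 1) (hy : A a (y.1 0) = 1) : Agree (m + 1) (pre a x) (pre a y) := by
  intro i hi
  cases i with
  | zero => rw [pre_zero hx, pre_zero hy]
  | succ i => rw [pre_succ hx, pre_succ hy]; exact h i (by omega)

theorem continuous_pre (a : Fin l) : Continuous (pre a : Subshift A → Subshift A) := by
  refine continuous_induced_rng.2 (continuous_pi fun i => ?_)
  have : (fun x : Subshift A => (pre a x).1 i) = fun x =>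
      (fun p : Fin l × Fin l × Fin l =>
        if A a p.1 = 1 then (if i = 0 then a else p.2.1) else p.2.2) (x.1 0, x.1 (i - 1), x.1 i) := by
    funext x
    by_cases h : A a (x.1 0) = 1
    · cases i with
      | zero => simp [pre_zero h, h]
      | succ i => simp [pre_succ h, h]
    · simp [pre, h]
  change Continuous (fun x : Subshift A => (pre a x).1 i)
  rw [this]
  exact Continuous.comp (g := fun p : Fin l × Fin l × Fin l =>
        if A a p.1 = 1 then (if i = 0 then a else p.2.1) else p.2.2) continuous_of_discreteTopology
    (f := fun x : Subshift A => (x.1 0, x.1 (i - 1), x.1 i)) ((continuous_coord 0).prodMk ((continuous_coord (i - 1)).prodMk (continuous_coord i)))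

theorem sum_fibre {M : Type*} [AddCommMonoid M] (F : Subshift A → M) (x : Subshift A) :
    ∑ y ∈ (finite_fibre x).toFinset, F y = ∑ a, if A a (x.1 0) = 1 then F (pre a x) else 0 := by
  rw [← Finset.sum_filter]
  symm
  refine Finset.sum_bij (fun a _ => pre a x) ?_ ?_ ?_ ?_
  · intro a ha
    simpa using shift_pre (Finset.mem_filter.1 ha).2
  · intro a ha b hb hab
    rw [← pre_zero (Finset.mem_filter.1 ha).2, ← pre_zero (Finset.mem_filter.1 hb).2, hab]
  · intro y hy
    have hy' : shift y = x := by simpa using hy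
    subst hy'
    exact ⟨y.1 0, by simpa using shift_allowed y, pre_shift y⟩
  · intro a _; rfl

/-- The transfer operator with weight `G` on real functions. -/
def op (G : Subshift A → ℝ) : Module.End ℝ (Subshift A → ℝ) where
  toFun f x := ∑ a, if A a (x.1 0) = 1 then G (pre a x) * f (pre a x) else 0
  map_add' f g := by
    funext x
    simp only [Pi.add_apply, ← Finset.sum_add_distrib]
    refine Finset.sum_congr rfl fun a _ => ?_
    split_ifs <;> ring
  map_smul' c f := by
    funext x
    simp only [Pi.smul_apply, smul_eq_mul, Finset.mul_sum, RingHom.id_apply]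
    refine Finset.sum_congr rfl fun a _ => ?_
    split_ifs <;> ring

theorem op_apply (G f : Subshift A → ℝ) (x : Subshift A) :
    op G f x = ∑ a, if A a (x.1 0) = 1 then G (pre a x) * f (pre a x) else 0 := rfl

theorem op_pow_succ (G f : Subshift A → ℝ) (n : ℕ) : (op G ^ (n + 1)) f = (op G ^ n) (op G f) := by
  rw [pow_succ, Module.End.mul_apply]

theorem op_pow_succ' (G f : Subshift A → ℝ) (n : ℕ) :
    (op G ^ (n + 1)) f = op G ((op G ^ n) f) := by
  rw [pow_succ', Module.End.mul_apply]

theorem op_mono {G G' f g : Subshift A → ℝ} (hG : 0 ≤ G) (hGG : G ≤ G') (hf : 0 ≤ f) (h : f ≤ g) :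
    op G f ≤ op G' g := by
  intro x
  rw [op_apply, op_apply]
  refine Finset.sum_le_sum fun a _ => ?_
  split_ifs
  · exact mul_le_mul (hGG _) (h _) (hf _) ((hG _).trans (hGG _))
  · exact le_rfl

theorem op_le_op {G f g : Subshift A → ℝ} (hG : 0 ≤ G) (h : f ≤ g) : op G f ≤ op G g := by
  intro x
  rw [op_apply, op_apply]
  refine Finset.sum_le_sum fun a _ => ?_
  split_ifs
  · exact mul_le_mul_of_nonneg_left (h _) (hG _)
  · exact le_rfl

theorem op_pow_le_op_pow {G f g : Subshift A → ℝ} (hG : 0 ≤ G) (h : f ≤ g) (n : ℕ) :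
    (op G ^ n) f ≤ (op G ^ n) g := by
  induction n generalizing f g with
  | zero => exact h
  | succ n ih => rw [op_pow_succ, op_pow_succ]; exact ih (op_le_op hG h)

theorem op_nonneg {G f : Subshift A → ℝ} (hG : 0 ≤ G) (hf : 0 ≤ f) : 0 ≤ op G f := by
  have := op_le_op (f := 0) (g := f) hG hf
  rwa [map_zero] at this

theorem op_pow_nonneg {G f : Subshift A → ℝ} (hG : 0 ≤ G) (hf : 0 ≤ f) (n : ℕ) :
    0 ≤ (op G ^ n) f := by
  have := op_pow_le_op_pow (f := 0) (g := f) hG hf n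
  rwa [map_zero] at this

theorem op_pow_mono {G G' f : Subshift A → ℝ} (hG : 0 ≤ G) (hGG : G ≤ G') (hf : 0 ≤ f) (n : ℕ) :
    (op G ^ n) f ≤ (op G' ^ n) f := by
  induction n with
  | zero => exact le_rfl
  | succ n ih =>
    rw [op_pow_succ', op_pow_succ']
    exact op_mono hG hGG (op_pow_nonneg hG hf n) ih

theorem op_eigen_pow {G h : Subshift A → ℝ} {r : ℝ} (e : op G h = r • h) (n : ℕ) :
    (op G ^ n) h = r ^ n • h := by
  induction n with
  | zero => simp
  | succ n ih => rw [op_pow_succ, e, map_smul, ih, smul_smul, pow_succ']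

theorem op_pow_le_of_op_le {G h : Subshift A → ℝ} {r : ℝ} (hG : 0 ≤ G) (hr : 0 ≤ r)
    (e : op G h ≤ r • h) (n : ℕ) : (op G ^ n) h ≤ r ^ n • h := by
  induction n with
  | zero => simp
  | succ n ih =>
    rw [op_pow_succ]
    refine (op_pow_le_op_pow hG e n).trans ?_
    rw [map_smul, pow_succ', mul_smul]
    exact smul_le_smul_of_nonneg_left ih hr

/-- `g ∘ σ` is constant on each fibre of the shift, so it can be pulled out of the sum over the
fibre. -/
theorem op_mul_comp_shift (G f g : Subshift A → ℝ) :
    op G (fun x => f x * g (shift x)) = fun x => op G f x * g x := by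
  funext x
  simp only [op_apply, Finset.sum_mul]
  refine Finset.sum_congr rfl fun a _ => ?_
  split_ifs with h
  · rw [shift_pre h]; ring
  · ring

theorem op_pow_mul_comp_shift (G f g : Subshift A → ℝ) (n : ℕ) :
    (op G ^ n) (fun x => f x * g (shift^[n] x)) = fun x => (op G ^ n) f x * g x := by
  induction n generalizing f with
  | zero => rfl
  | succ n ih =>
    rw [op_pow_succ, op_pow_succ, ← ih]
    congr 1
    exact op_mul_comp_shift G f (fun x => g (shift^[n] x))

theorem le_op_shift {G f : Subshift A → ℝ} (hG : 0 ≤ G) (hf : 0 ≤ f) (y : Subshift A) :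
    G y * f y ≤ op G f (shift y) := by
  have h := Finset.single_le_sum (f := fun a => if A a ((shift y).1 0) = 1 then
    G (pre a (shift y)) * f (pre a (shift y)) else 0) (s := Finset.univ) (fun a _ => by
      split_ifs
      · exact mul_nonneg (hG _) (hf _)
      · exact le_rfl) (Finset.mem_univ (y.1 0))
  rw [if_pos (shift_allowed y), pre_shift] at h
  exact h

/-- All terms in the sum over `n`-fold preimages are nonnegative, so the single branch through `y`
bounds it from below. -/
theorem le_op_pow_shift {G f : Subshift A → ℝ} (hG : 0 ≤ G) (hf : 0 ≤ f) (n : ℕ)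
    (y : Subshift A) :
    (∏ i ∈ Finset.range n, G (shift^[i] y)) * f y ≤ (op G ^ n) f (shift^[n] y) := by
  induction n generalizing f y with
  | zero => simp
  | succ n ih =>
    rw [op_pow_succ, Function.iterate_succ_apply, Finset.prod_range_succ']
    refine le_trans ?_ (ih (op_nonneg hG hf) (shift y))
    simp only [Function.iterate_succ_apply, Function.iterate_zero, id]
    rw [mul_assoc]
    exact mul_le_mul_of_nonneg_left (le_op_shift hG hf y) (Finset.prod_nonneg fun i _ => hG _)

theorem continuous_op {G f : Subshift A → ℝ} (hG : Continuous G) (hf : Continuous f) :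
    Continuous (op G f) := by
  have : op G f = fun x => ∑ a, (fun b : Fin l => if A a b = 1 then (1 : ℝ) else 0) (x.1 0) *
      (G (pre a x) * f (pre a x)) := by
    funext x
    rw [op_apply]
    refine Finset.sum_congr rfl fun a _ => ?_
    by_cases h : A a (x.1 0) = 1 <;> simp [h]
  rw [this]
  refine continuous_finsetSum _ fun a _ => Continuous.mul ?_ ?_
  · exact continuous_comp_coord (fun b : Fin l => if A a b = 1 then (1 : ℝ) else 0) 0
  exact ((hG.comp (continuous_pre a)).mul (hf.comp (continuous_pre a)))

theorem continuous_op_pow {G f : Subshift A → ℝ} (hG : Continuous G) (hf : Continuous f) (n : ℕ) :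
    Continuous ((op G ^ n) f) := by
  induction n with
  | zero => exact hf
  | succ n ih => rw [op_pow_succ']; exact continuous_op hG ih

/-- Replacing the tail of `x` from coordinate `n` on by a point that agrees with it. -/
theorem exists_glue (n m : ℕ) (x y : Subshift A) (h : Agree (m + 1) (shift^[n] x) y) :
    ∃ w : Subshift A, shift^[n] w = y ∧ Agree (n + m + 1) w x := by
  induction n generalizing x with
  | zero => exact ⟨y, rfl, by simpa using h.symm⟩
  | succ n ih =>
    obtain ⟨w, hw, hwx⟩ := ih (shift x) h
    have ha : A (x.1 0) (w.1 0) = 1 := by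
      rw [hwx 0 (by omega)]; exact shift_allowed x
    refine ⟨pre (x.1 0) w, by rw [Function.iterate_succ_apply, shift_pre ha, hw], ?_⟩
    have := hwx.pre ha (shift_allowed x)
    rw [pre_shift] at this
    exact this.mono (by omega)

theorem exists_path (hA : ∀ i j, A i j = 0 ∨ A i j = 1) (d : ℕ) (i : Fin l) (x : Subshift A)
    (h : 0 < (A ^ d) i (x.1 0)) : ∃ y : Subshift A, y.1 0 = i ∧ shift^[d] y = x := by
  induction d generalizing i with
  | zero =>
    refine ⟨x, ?_, rfl⟩
    by_contra hne
    simp [Matrix.one_apply_ne (Ne.symm hne)] at h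
  | succ d ih =>
    rw [pow_succ', Matrix.mul_apply] at h
    obtain ⟨j, -, hj⟩ := Finset.exists_ne_zero_of_sum_ne_zero h.ne'
    obtain ⟨y, hy, hyx⟩ := ih j (Nat.pos_of_ne_zero (right_ne_zero_of_mul hj))
    have ha : A i (y.1 0) = 1 := by
      rw [hy]; exact (hA i j).resolve_left (left_ne_zero_of_mul hj)
    exact ⟨pre i y, pre_zero ha, by rw [Function.iterate_succ_apply, shift_pre ha, hyx]⟩

/-- Topological mixing: every point has preimages in every cylinder. -/
theorem exists_preimage_mem_cylinder (hA : ∀ i j, A i j = 0 ∨ A i j = 1) {d : ℕ}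
    (hd : ∀ i j, 0 < (A ^ d) i j) (q : ℕ) (x y : Subshift A) :
    ∃ w : Subshift A, Agree q w x ∧ shift^[q + d] w = y := by
  obtain ⟨v, hv, hvy⟩ := exists_path hA d (x.1 q) y (hd _ _)
  obtain ⟨w, hw, hwx⟩ := exists_glue q 0 x v (by
    intro i hi
    obtain rfl : i = 0 := by omega
    rw [shift_iterate_apply, hv, zero_add])
  exact ⟨w, hwx.mono (by omega), by rw [add_comm, Function.iterate_add_apply, hw, hvy]⟩

theorem exists_preimage (hA : ∀ i j, A i j = 0 ∨ A i j = 1) {d : ℕ} (h0 : 0 < d)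
    (hd : ∀ i j, 0 < (A ^ d) i j) (x : Subshift A) : ∃ y : Subshift A, shift y = x := by
  obtain ⟨y, -, hy⟩ := exists_path hA d (x.1 0) x (hd _ _)
  obtain ⟨k, rfl⟩ : ∃ k, d = k + 1 := ⟨d - 1, by omega⟩
  exact ⟨shift^[k] y, by rw [← Function.iterate_succ_apply' shift, hy]⟩

/-- A point in each nonempty cylinder of length `m`. -/
theorem exists_representatives [Nonempty (Subshift A)] (m : ℕ) :
    ∃ R : (Fin m → Fin l) → Subshift A, ∀ x : Subshift A, Agree m x (R fun i => x.1 i) := by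
  classical
  refine ⟨fun u => if h : ∃ x : Subshift A, ∀ i : Fin m, x.1 i = u i then h.choose else
    Classical.arbitrary _, fun x i hi => ?_⟩
  have h : ∃ y : Subshift A, ∀ i : Fin m, y.1 i = (fun i : Fin m => x.1 i) i := ⟨x, fun _ => rfl⟩
  dsimp only
  rw [dif_pos h]
  exact (h.choose_spec ⟨i, hi⟩).symm

end Operator

/-! ### Growth rate of a positive transfer operator and its eigenfunction -/

section Spectral

variable {l : ℕ} {A : Matrix (Fin l) (Fin l) ℕ}

theorem exists_bound {f : Subshift A → ℝ} (hf : Continuous f) : ∃ M, 0 < M ∧ ∀ x, |f x| ≤ M := by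
  obtain ⟨M, hM⟩ := isCompact_univ.exists_bound_of_continuousOn hf.continuousOn
  exact ⟨max M 1, by positivity, fun x => (hM x (mem_univ x)).trans (le_max_left _ _)⟩

/-- Nonnegative functions whose logarithm is Hölder on each cylinder of length `q`. -/
structure LogHolder (θ B : ℝ) (q : ℕ) (f : Subshift A → ℝ) : Prop where
  nonneg : 0 ≤ f
  le_mul : ∀ m, q ≤ m → ∀ x y, Agree m x y → f x ≤ Real.exp (B * θ ^ m) * f y

theorem logHolder_one {θ B : ℝ} (hθ : 0 < θ) (hB : 0 ≤ B) (q : ℕ) :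
    LogHolder θ B q (1 : Subshift A → ℝ) where
  nonneg _ := zero_le_one
  le_mul m _ _ _ _ := by simpa using Real.one_le_exp (show 0 ≤ B * θ ^ m by positivity)

namespace LogHolder

variable {θ B C : ℝ} {q : ℕ} {f G : Subshift A → ℝ}

theorem continuous (hθ : 0 < θ) (hθ' : θ < 1) (h : LogHolder θ B q f) : Continuous f := by
  rw [continuous_iff_continuousAt]
  intro x
  have hlim : Tendsto (fun m : ℕ => B * θ ^ m) atTop (𝓝 0) := by
    simpa using (tendsto_pow_atTop_nhds_zero_of_lt_one hθ.le hθ').const_mul B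
  have h1 : Tendsto (fun m : ℕ => Real.exp (B * θ ^ m) * f x) atTop (𝓝 (f x)) := by
    simpa using ((Real.continuous_exp.tendsto 0).comp hlim).mul_const (f x)
  have h2 : Tendsto (fun m : ℕ => Real.exp (-(B * θ ^ m)) * f x) atTop (𝓝 (f x)) := by
    have := hlim.neg
    rw [neg_zero] at this
    simpa using ((Real.continuous_exp.tendsto 0).comp this).mul_const (f x)
  refine tendsto_order.2 ⟨fun a ha => ?_, fun b hb => ?_⟩
  · obtain ⟨m, hm, hqm⟩ := ((h2.eventually (lt_mem_nhds ha)).and (eventually_ge_atTop q)).exists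
    filter_upwards [(isOpen_cylinder x m).mem_nhds (Agree.refl m x)] with y hy
    refine hm.trans_le ?_
    rw [Real.exp_neg, inv_mul_le_iff₀ (Real.exp_pos _)]
    exact h.le_mul m hqm x y (Agree.symm hy)
  · obtain ⟨m, hm, hqm⟩ := ((h1.eventually (gt_mem_nhds hb)).and (eventually_ge_atTop q)).exists
    filter_upwards [(isOpen_cylinder x m).mem_nhds (Agree.refl m x)] with y hy
    exact (h.le_mul m hqm y x hy).trans_lt hm

/-- Prepending a symbol turns `m` common coordinates into `m + 1`, so weight and function together
contribute the exponent `(C + B) θ^(m+1) ≤ B θ^m`. Since `1 ≤ q`, the two points share their first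
symbol and hence have the same admissible branches. -/
theorem op_logHolder (hG : LogHolder θ C q G) (hf : LogHolder θ B q f) (hq : 1 ≤ q)
    (hθ : 0 < θ) (hCB : (C + B) * θ ≤ B) : LogHolder θ B q (op G f) where
  nonneg := op_nonneg hG.nonneg hf.nonneg
  le_mul m hm x y hxy := by
    rw [op_apply, op_apply, Finset.mul_sum]
    refine Finset.sum_le_sum fun a _ => ?_
    have h0 : x.1 0 = y.1 0 := hxy 0 (by omega)
    by_cases ha : A a (x.1 0) = 1
    · have ha' : A a (y.1 0) = 1 := h0 ▸ ha
      rw [if_pos ha, if_pos ha']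
      have hag := hxy.pre ha ha'
      have h1 := hG.le_mul (m + 1) (by omega) _ _ hag
      have h2 := hf.le_mul (m + 1) (by omega) _ _ hag
      refine (mul_le_mul h1 h2 (hf.nonneg _) (mul_nonneg (Real.exp_nonneg _) (hG.nonneg _))).trans ?_
      rw [mul_mul_mul_comm, ← Real.exp_add]
      refine mul_le_mul_of_nonneg_right (Real.exp_le_exp.2 ?_)
        (mul_nonneg (hG.nonneg _) (hf.nonneg _))
      have : 0 ≤ θ ^ m := by positivity
      rw [pow_succ]
      nlinarith
    · have ha' : ¬ A a (y.1 0) = 1 := h0 ▸ ha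
      rw [if_neg ha, if_neg ha', mul_zero]

theorem op_pow_logHolder (hG : LogHolder θ C q G) (hf : LogHolder θ B q f) (hq : 1 ≤ q)
    (hθ : 0 < θ) (hCB : (C + B) * θ ≤ B) (n : ℕ) : LogHolder θ B q ((op G ^ n) f) := by
  induction n with
  | zero => exact hf
  | succ n ih => rw [op_pow_succ']; exact hG.op_logHolder ih hq hθ hCB

/-- A log-Hölder function is bounded below where it does not vanish. -/
theorem exists_lower_bound [Nonempty (Subshift A)] (h : LogHolder θ B q f) :
    ∃ c, 0 < c ∧ ∀ x, f x ≠ 0 → c ≤ f x := by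
  obtain ⟨R, hR⟩ := exists_representatives (A := A) q
  let F : (Fin q → Fin l) → ℝ := fun u => if f (R u) = 0 then 1 else f (R u)
  have hF : ∀ u, 0 < F u := fun u => by
    dsimp only [F]
    split_ifs with h0
    · exact one_pos
    · exact (h.nonneg _).lt_of_ne' h0
  obtain ⟨x0⟩ := (inferInstance : Nonempty (Subshift A))
  have : Nonempty (Fin q → Fin l) := ⟨fun i => x0.1 i⟩
  obtain ⟨u0, hu0⟩ := Finite.exists_min F
  refine ⟨Real.exp (-(B * θ ^ q)) * F u0, mul_pos (Real.exp_pos _) (hF _), fun x hx => ?_⟩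
  have hxR := hR x
  set u := fun i : Fin q => x.1 i
  have h1 : f (R u) ≠ 0 := fun h0 => hx (le_antisymm (by
    simpa [h0] using h.le_mul q le_rfl _ _ hxR) (h.nonneg x))
  have h2 : F u = f (R u) := if_neg h1
  rw [Real.exp_neg, inv_mul_le_iff₀ (Real.exp_pos _)]
  exact (hu0 u).trans (h2 ▸ h.le_mul q le_rfl _ _ hxR.symm)

end LogHolder

/-- Exponential rates that dominate the growth of the iterates of `op G`. -/
def growthRates (G : Subshift A → ℝ) : Set ℝ :=
  {s | 0 < s ∧ ∃ C, 0 < C ∧ ∀ n x, (op G ^ n) 1 x ≤ C * s ^ n}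

/-- The exponential growth rate of the iterates of `op G`. -/
def radius (G : Subshift A → ℝ) : ℝ := sInf (growthRates G)

variable {G : Subshift A → ℝ}

theorem bddBelow_growthRates : BddBelow (growthRates G) := ⟨0, fun _ hs => hs.1.le⟩

theorem mem_growthRates_of_le {s t : ℝ} (hs : s ∈ growthRates G) (h : s ≤ t) :
    t ∈ growthRates G := by
  obtain ⟨h0, C, hC, hs⟩ := hs
  exact ⟨h0.trans_le h, C, hC, fun n x => (hs n x).trans
    (mul_le_mul_of_nonneg_left (pow_le_pow_left₀ h0.le h n) hC.le)⟩

theorem op_one_pow_le {M : ℝ} (hG : 0 ≤ G) (hM : 0 ≤ M) (h : ∀ x, G x ≤ M) (n : ℕ) :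
    (op G ^ n) 1 ≤ (l * M) ^ n • (1 : Subshift A → ℝ) := by
  refine op_pow_le_of_op_le hG (by positivity) ?_ n
  intro x
  rw [op_apply]
  refine (Finset.sum_le_sum (g := fun _ => M) fun a _ => ?_).trans ?_
  · split_ifs
    · simpa using h _
    · exact hM
  · simp

theorem growthRates_nonempty (hG : 0 ≤ G) (hc : Continuous G) : (growthRates G).Nonempty := by
  obtain ⟨M, hM, h⟩ := exists_bound hc
  refine ⟨l * M + 1, by positivity, 1, one_pos, fun n x => ?_⟩
  refine (op_one_pow_le hG hM.le (fun x => (le_abs_self _).trans (h x)) n x).trans ?_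
  simp only [Pi.smul_apply, Pi.one_apply, smul_eq_mul, mul_one, one_mul]
  exact pow_le_pow_left₀ (by positivity) (by linarith) n

theorem mem_growthRates_of_radius_lt (hG : 0 ≤ G) (hc : Continuous G) {s : ℝ}
    (h : radius G < s) : s ∈ growthRates G := by
  obtain ⟨t, ht, hts⟩ := exists_lt_of_csInf_lt (growthRates_nonempty hG hc) h
  exact mem_growthRates_of_le ht hts.le

theorem radius_nonneg : 0 ≤ radius G := Real.sInf_nonneg fun _ hs => hs.1.le

theorem radius_mono {G' : Subshift A → ℝ} (hG : 0 ≤ G) (h : G ≤ G') (hc : Continuous G') :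
    radius G ≤ radius G' := by
  refine csInf_le_csInf bddBelow_growthRates (growthRates_nonempty (hG.trans h) hc) ?_
  rintro s ⟨h0, C, hC, hs⟩
  exact ⟨h0, C, hC, fun n x => (op_pow_mono hG h (fun _ => zero_le_one) n x).trans (hs n x)⟩

/-- The resolvent of `op G` at `s` applied to the constant function one. -/
def resolventOne (G : Subshift A → ℝ) (s : ℝ) (x : Subshift A) : ℝ :=
  ∑' k : ℕ, (s ^ (k + 1))⁻¹ * (op G ^ k) 1 x

theorem summable_resolventOne (hG : 0 ≤ G) (hc : Continuous G) {s : ℝ} (h : radius G < s)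
    (x : Subshift A) : Summable fun k : ℕ => (s ^ (k + 1))⁻¹ * (op G ^ k) 1 x := by
  obtain ⟨t, hrt, hts⟩ := exists_between h
  obtain ⟨h0, C, hC, ht⟩ := mem_growthRates_of_radius_lt hG hc hrt
  have hs : 0 < s := h0.trans hts
  refine Summable.of_nonneg_of_le (f := fun k => C / s * (t / s) ^ k) (fun k => ?_) (fun k => ?_)
    ((summable_geometric_of_lt_one (by positivity) ((div_lt_one hs).2 hts)).mul_left _)
  · exact mul_nonneg (by positivity) (op_pow_nonneg hG (fun _ => zero_le_one) k x)
  · refine (mul_le_mul_of_nonneg_left (ht k x) (by positivity)).trans (le_of_eq ?_)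
    rw [div_pow, pow_succ]
    field_simp

/-- The operator is a finite sum at each point, so it acts on the series term by term, and the
result is the series multiplied by `s` without its first term. -/
theorem op_resolventOne (hG : 0 ≤ G) (hc : Continuous G) {s : ℝ} (h : radius G < s) :
    op G (resolventOne G s) = s • resolventOne G s - 1 := by
  have hs : 0 < s := radius_nonneg.trans_lt h
  funext x
  have h1 : HasSum (fun k : ℕ => (s ^ (k + 1))⁻¹ * (op G ^ (k + 1)) 1 x)
      (op G (resolventOne G s) x) := by
    simp only [op_pow_succ', op_apply, Finset.mul_sum]
    refine hasSum_sum fun a _ => ?_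
    by_cases ha : A a (x.1 0) = 1
    · simp only [if_pos ha]
      have h3 := ((summable_resolventOne hG hc h (pre a x)).hasSum).mul_left (G (pre a x))
      have h4 : (fun k : ℕ => (s ^ (k + 1))⁻¹ * (G (pre a x) * (op G ^ k) 1 (pre a x))) =
          fun k : ℕ => G (pre a x) * ((s ^ (k + 1))⁻¹ * (op G ^ k) 1 (pre a x)) := by
        funext k; ring
      rw [h4]
      exact h3
    · simp only [if_neg ha, mul_zero]
      exact hasSum_zero
  have h2 := ((hasSum_nat_add_iff' 1).2 ((summable_resolventOne hG hc h x).hasSum)).mul_left s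
  have h3 : (fun k : ℕ => s * ((s ^ (k + 1 + 1))⁻¹ * (op G ^ (k + 1)) 1 x)) =
      fun k : ℕ => (s ^ (k + 1))⁻¹ * (op G ^ (k + 1)) 1 x := by
    funext k
    rw [pow_succ s (k + 1), mul_inv]
    field_simp
  rw [h3] at h2
  rw [h1.unique h2, ← resolventOne]
  simp [mul_sub, hs.ne']

theorem le_resolventOne (hG : 0 ≤ G) (hc : Continuous G) {s : ℝ} (h : radius G < s)
    (x : Subshift A) : s⁻¹ ≤ resolventOne G s x := by
  have hs : 0 < s := radius_nonneg.trans_lt h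
  have := (summable_resolventOne hG hc h x).le_tsum 0 (fun k _ =>
    mul_nonneg (by positivity) (op_pow_nonneg hG (fun _ => zero_le_one) k x))
  rw [← resolventOne] at this
  simpa using this

/-- The resolvent blows up at the growth rate. -/
theorem inv_le_of_resolventOne_le (hG : 0 ≤ G) (hc : Continuous G) {s M : ℝ} (hr : 0 < radius G)
    (h : radius G < s) (hM : 0 < M) (hgM : ∀ x, resolventOne G s x ≤ M) : M⁻¹ ≤ s - radius G := by
  have hs : 0 < s := hr.trans h
  by_contra! hlt
  -- If `s - radius G < 1/M`, this `t` is below the radius. But the resolvent `g ≤ M` satisfies `op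
  -- G g = s g - 1 ≤ (s - 1/M) g ≤ t g`, which makes `t` a growth rate, a contradiction. The term
  -- `radius G / 2` keeps `t` positive.
  set t := max (s - M⁻¹) (radius G / 2) with ht
  have ht0 : 0 < t := lt_of_lt_of_le (by positivity) (le_max_right _ _)
  have htr : t < radius G := max_lt (by linarith) (by linarith)
  refine absurd (csInf_le bddBelow_growthRates (?_ : t ∈ growthRates G)) (not_le.2 htr)
  have hle : op G (resolventOne G s) ≤ t • resolventOne G s := by
    intro x
    rw [op_resolventOne hG hc h]
    simp only [Pi.sub_apply, Pi.smul_apply, Pi.one_apply, smul_eq_mul]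
    have h1 : (s - M⁻¹) * resolventOne G s x ≤ t * resolventOne G s x :=
      mul_le_mul_of_nonneg_right (le_max_left _ _)
        ((inv_nonneg.2 hs.le).trans (le_resolventOne hG hc h x))
    have h2 : M⁻¹ * resolventOne G s x ≤ 1 := by
      rw [inv_mul_le_iff₀ hM, mul_one]; exact hgM x
    linarith
  refine ⟨ht0, s * M, by positivity, fun n x => ?_⟩
  have h1 : (1 : Subshift A → ℝ) ≤ s • resolventOne G s := fun x => by
    simp only [Pi.smul_apply, Pi.one_apply, smul_eq_mul]
    have := mul_le_mul_of_nonneg_left (le_resolventOne hG hc h x) hs.le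
    rwa [mul_inv_cancel₀ hs.ne'] at this
  have h2 := op_pow_le_op_pow hG h1 n x
  rw [map_smul] at h2
  refine h2.trans ?_
  have h3 := op_pow_le_of_op_le hG ht0.le hle n x
  simp only [Pi.smul_apply, smul_eq_mul] at h3 ⊢
  have h4 := mul_le_mul_of_nonneg_left (hgM x) (pow_nonneg ht0.le n)
  have := mul_le_mul_of_nonneg_left (h3.trans h4) hs.le
  linarith

/-- A positive transfer operator has an eigenfunction for its growth rate. -/
theorem exists_eigenfunction [Nonempty (Subshift A)] {θ B C : ℝ} {q : ℕ} (hG : LogHolder θ C q G)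
    (hq : 1 ≤ q) (hθ : 0 < θ) (hθ' : θ < 1) (hB : 0 ≤ B) (hCB : (C + B) * θ ≤ B)
    (hr : 0 < radius G) :
    ∃ h : Subshift A → ℝ, LogHolder θ B q h ∧ (∃ x, 0 < h x) ∧ op G h = radius G • h := by
  obtain ⟨R, hR⟩ := exists_representatives (A := A) q
  have hc := hG.continuous hθ hθ'
  set r := radius G
  let s : ℕ → ℝ := fun j => r + 1 / ((j : ℝ) + 1)
  have hs : ∀ j, r < s j := fun j => lt_add_of_pos_right _ (by positivity)
  have hslim : Tendsto s atTop (𝓝 r) := by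
    simpa [s] using (tendsto_one_div_add_atTop_nhds_zero_nat (𝕜 := ℝ)).const_add r
  let g : ℕ → Subshift A → ℝ := fun j => resolventOne G (s j)
  have hs0 : ∀ j, 0 < s j := fun j => hr.trans (hs j)
  have hgpos : ∀ j x, 0 < g j x := fun j x =>
    (inv_pos.2 (hs0 j)).trans_le (le_resolventOne hG.nonneg hc (hs j) x)
  have hgH : ∀ j, LogHolder θ B q (g j) := fun j => by
    refine ⟨fun x => (hgpos j x).le, fun m hm x y hxy => ?_⟩
    change ∑' k : ℕ, _ ≤ _ * ∑' k : ℕ, _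
    rw [← tsum_mul_left]
    refine (summable_resolventOne hG.nonneg hc (hs j) x).tsum_le_tsum (fun k => ?_)
      ((summable_resolventOne hG.nonneg hc (hs j) y).mul_left _)
    rw [mul_left_comm]
    have := hs0 j
    exact mul_le_mul_of_nonneg_left ((hG.op_pow_logHolder (logHolder_one hθ hB q) hq hθ hCB
      k).le_mul m hm x y hxy) (by positivity)
  -- The sum over one representative per word controls the supremum of `g j` up to the factor `E`,
  -- uniformly in `j`, because all `g j` satisfy the same log-Hölder condition.
  let N : ℕ → ℝ := fun j => ∑ u, g j (R u)
  set E := Real.exp (B * θ ^ q)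
  have hgN : ∀ j x, g j x ≤ E * N j := fun j x => ((hgH j).le_mul q le_rfl _ _ (hR x)).trans
    (mul_le_mul_of_nonneg_left (Finset.single_le_sum (f := fun u => g j (R u))
      (fun u _ => (hgpos j _).le) (Finset.mem_univ _)) (Real.exp_nonneg _))
  obtain ⟨x0⟩ := (inferInstance : Nonempty (Subshift A))
  have hEN : ∀ j, 0 < E * N j := fun j => (hgpos j x0).trans_le (hgN j x0)
  have hN : ∀ j, 0 < N j := fun j => pos_of_mul_pos_right (hEN j) (Real.exp_nonneg _)
  -- Blow-up of the resolvent: after normalisation the inhomogeneous term `1` in the resolvent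
  -- equation disappears in the limit.
  have hNlim : Tendsto (fun j => (N j)⁻¹) atTop (𝓝 0) := by
    refine squeeze_zero (g := fun j => E * (s j - r)) (fun j => (inv_pos.2 (hN j)).le) (fun j => ?_)
      (by simpa using (hslim.sub_const r).const_mul E)
    have := inv_le_of_resolventOne_le hG.nonneg hc hr (hs j) (hEN j) (hgN j)
    rw [mul_inv, inv_mul_le_iff₀ (Real.exp_pos _)] at this
    exact this
  let f : ℕ → Subshift A → ℝ := fun j x => (N j)⁻¹ * g j x
  have hf0 : ∀ j x, 0 ≤ f j x := fun j x => mul_nonneg (inv_pos.2 (hN j)).le (hgpos j x).le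
  have hfE : ∀ j x, f j x ≤ E := fun j x => by
    rw [inv_mul_le_iff₀ (hN j), mul_comm]; exact hgN j x
  -- Pointwise limits along an ultrafilter suffice: the cone condition is closed under them, and the
  -- operator commutes with them as a finite sum.
  let 𝒰 : Ultrafilter ℕ := Ultrafilter.of atTop
  have h𝒰 : (𝒰 : Filter ℕ) ≤ atTop := Ultrafilter.of_le _
  have hlim : ∀ x, ∃ a, Tendsto (fun j => f j x) 𝒰 (𝓝 a) := fun x => by
    obtain ⟨a, -, ha⟩ := isCompact_Icc.ultrafilter_le_nhds (𝒰.map fun j => f j x)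
      (by
        rw [le_principal_iff]
        exact Filter.Eventually.of_forall (f := (𝒰 : Filter ℕ))
          (p := fun j => f j x ∈ Icc 0 E) fun j => ⟨hf0 j x, hfE j x⟩)
    exact ⟨a, ha⟩
  choose h hh using hlim
  refine ⟨h, ⟨fun x => ge_of_tendsto' (hh x) fun j => hf0 j x, fun m hm x y hxy => ?_⟩, ?_, ?_⟩
  · refine le_of_tendsto_of_tendsto' (hh x) ((hh y).const_mul _) fun j => ?_
    rw [mul_left_comm]
    exact mul_le_mul_of_nonneg_left ((hgH j).le_mul m hm x y hxy) (inv_pos.2 (hN j)).le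
  · have hsum : ∑ u, h (R u) = 1 := by
      refine tendsto_nhds_unique (tendsto_finsetSum _ fun u _ => hh (R u)) ?_
      refine (tendsto_congr fun j => ?_).2 tendsto_const_nhds
      rw [← Finset.mul_sum]
      exact inv_mul_cancel₀ (hN j).ne'
    obtain ⟨u, -, hu⟩ := Finset.exists_ne_zero_of_sum_ne_zero (hsum.symm ▸ one_ne_zero)
    exact ⟨R u, (ge_of_tendsto' (hh (R u)) fun j => hf0 j _).lt_of_ne' hu⟩
  · funext x
    have h1 : Tendsto (fun j => op G (f j) x) 𝒰 (𝓝 (op G h x)) := by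
      simp only [op_apply]
      refine tendsto_finsetSum _ fun a _ => ?_
      split_ifs
      · exact (hh _).const_mul _
      · exact tendsto_const_nhds
    have h2 : ∀ j, op G (f j) x = s j * f j x - (N j)⁻¹ := fun j => by
      have : f j = (N j)⁻¹ • g j := rfl
      rw [this, map_smul, op_resolventOne hG.nonneg hc (hs j)]
      simp only [Pi.smul_apply, Pi.sub_apply, Pi.one_apply, smul_eq_mul, g]
      ring
    refine tendsto_nhds_unique h1 ?_
    simp only [h2]
    simpa using ((hslim.mono_left h𝒰).mul (hh x)).sub (hNlim.mono_left h𝒰)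

/-- A nonnegative function expanded by an iterate bounds the growth rate from below. -/
theorem le_radius_pow (hG : 0 ≤ G) (hc : Continuous G) {N : ℕ} {c t : ℝ} (hc0 : 0 < c)
    (x : Subshift A) (h : ∀ j, c * t ^ j ≤ (op G ^ (N * j)) 1 x) :
    t ≤ radius G ^ N := by
  have key : ∀ s ∈ growthRates G, t ≤ s ^ N := by
    rintro s ⟨hs, C, hC, hsC⟩
    by_contra! hlt
    have h1 : 1 < t / s ^ N := (one_lt_div (by positivity)).2 hlt
    obtain ⟨j, hj⟩ := pow_unbounded_of_one_lt (C / c) h1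
    have h2 := (h j).trans (hsC (N * j) x)
    rw [div_pow, div_lt_div_iff₀ hc0 (by positivity), ← pow_mul] at hj
    linarith
  -- The infimum defining the radius need not be attained, so the bound is passed to the limit from
  -- the right.
  have hcl : ∀ᶠ s in 𝓝[>] radius G, t ≤ s ^ N := by
    filter_upwards [self_mem_nhdsWithin] with s hs
    exact key s (mem_growthRates_of_radius_lt hG hc hs)
  exact ge_of_tendsto (((continuous_pow N).tendsto (radius G)).mono_left nhdsWithin_le_nhds) hcl

end Spectral

/-! ### Gibbs inequality for partition entropy -/

section GibbsInequality

theorem integral_eq_sum_fibres {X ι : Type*} [MeasurableSpace X] [Fintype ι]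
    [MeasurableSpace ι] [MeasurableSingletonClass ι] {μ : Measure X}
    {f : X → ι} (hf : Measurable f) {b : X → ℝ} (hb : Integrable b μ) :
    ∫ x, b x ∂μ = ∑ a, ∫ x in f ⁻¹' {a}, b x ∂μ := by
  rw [← integral_iUnion_fintype (fun a => hf (measurableSet_singleton a)) ?_
    fun a => hb.integrableOn]
  · have : ⋃ a, f ⁻¹' {a} = univ := by ext x; simp
    rw [this, setIntegral_univ]
  · intro a c hac
    refine Set.disjoint_left.2 fun x hx hx' => hac ?_
    rw [← (show f x = a from hx), ← (show f x = c from hx')]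

/-- Apply `log t ≤ t - 1` to the ratio of the reference weight `q a` and the mass of the cell, and
sum over cells; the total weight is at most 1, so the correction terms are harmless. -/
theorem partitionEntropy_le_integral {X ι : Type*} [MeasurableSpace X] [Fintype ι]
    [MeasurableSpace ι] [MeasurableSingletonClass ι] {μ : Measure X} [IsProbabilityMeasure μ]
    {f : X → ι} (hf : Measurable f) {q : ι → ℝ} (hq : ∀ a, 0 ≤ q a) (hq1 : ∑ a, q a ≤ 1)
    {b : X → ℝ} (hb : Integrable b μ) (h : ∀ᵐ x ∂μ, Real.exp (-b x) ≤ q (f x)) :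
    partitionEntropy μ f ≤ ∫ x, b x ∂μ := by
  classical
  have hS : ∀ a, MeasurableSet (f ⁻¹' {a}) := fun a => hf (measurableSet_singleton a)
  have hsplit := integral_eq_sum_fibres hf hb
  have hp1 : ∑ a, μ.real (f ⁻¹' {a}) = 1 := by
    rw [← measureReal_biUnion_finset (fun a _ c _ hac => Set.disjoint_left.2 fun x hx hx' => hac (by
      rw [← (show f x = a from hx), ← (show f x = c from hx')])) fun a _ => hS a]
    have : ⋃ a ∈ Finset.univ, f ⁻¹' {a} = univ := by ext x; simp
    rw [this]
    exact probReal_univ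
  have key : ∀ a, Real.negMulLog (μ.real (f ⁻¹' {a})) ≤
      ∫ x in f ⁻¹' {a}, b x ∂μ + (q a - μ.real (f ⁻¹' {a})) := by
    intro a
    by_cases hne : μ (f ⁻¹' {a}) = 0
    · rw [setIntegral_measure_zero _ hne, measureReal_def, hne]
      simpa using hq a
    · have hpos : 0 < μ.real (f ⁻¹' {a}) := ENNReal.toReal_pos hne (measure_ne_top _ _)
      set p := μ.real (f ⁻¹' {a}) with hp
      have hqa : 0 < q a := by
        by_contra hqa
        refine hne (measure_mono_null (t := {x | ¬ Real.exp (-b x) ≤ q (f x)}) ?_ (ae_iff.1 h))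
        intro x hx hx'
        rw [show f x = a from hx] at hx'
        exact hqa ((Real.exp_pos _).trans_le hx')
      have hint : p * (-Real.log (q a)) ≤ ∫ x in f ⁻¹' {a}, b x ∂μ := by
        have h1 : ∫ _ in f ⁻¹' {a}, (-Real.log (q a)) ∂μ = p * (-Real.log (q a)) := by
          rw [setIntegral_const, smul_eq_mul]
        rw [← h1]
        refine setIntegral_mono_on_ae (integrableOn_const) hb.integrableOn (hS a) ?_
        filter_upwards [h] with x hx hxa
        rw [show f x = a from hxa] at hx
        have := (Real.le_log_iff_exp_le hqa).2 hx
        linarith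
      have hlog := Real.log_le_sub_one_of_pos (div_pos hqa hpos)
      rw [Real.log_div hqa.ne' hpos.ne'] at hlog
      have h2 := mul_le_mul_of_nonneg_left hlog hpos.le
      have h3 : p * (q a / p - 1) = q a - p := by
        have := hpos.ne'
        field_simp
      rw [Real.negMulLog]
      linarith [h2, h3, hint, mul_sub p (Real.log (q a)) (Real.log p)]
  calc partitionEntropy μ f ≤ ∑ a, (∫ x in f ⁻¹' {a}, b x ∂μ + (q a - μ.real (f ⁻¹' {a}))) :=
        Finset.sum_le_sum fun a _ => key a
    _ ≤ ∫ x, b x ∂μ := by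
        rw [Finset.sum_add_distrib, Finset.sum_sub_distrib, hp1, ← hsplit]
        linarith

end GibbsInequality

/-! ### Approximation by finitely many coordinates -/

section Approximation

variable {l : ℕ} {A : Matrix (Fin l) (Fin l) ℕ}

theorem isClosed_agree (m : ℕ) : IsClosed {p : Subshift A × Subshift A | Agree m p.1 p.2} := by
  have : {p : Subshift A × Subshift A | Agree m p.1 p.2} =
      ⋂ i : ℕ, ⋂ _ : i < m, {p : Subshift A × Subshift A | p.1.1 i = p.2.1 i} := by
    ext p; simp [Agree]
  rw [this]
  exact isClosed_iInter fun i => isClosed_iInter fun _ => isClosed_eq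
    ((continuous_coord i).comp continuous_fst) ((continuous_coord i).comp continuous_snd)

/-- Pairs that violate the bound and agree on `m` coordinates would form a decreasing sequence of
nonempty compact sets, whose intersection lies on the diagonal. -/
theorem exists_agree_modulus {φ : Subshift A → ℝ} (hφ : Continuous φ) {ε : ℝ} (hε : 0 < ε) :
    ∃ m, ∀ x y, Agree m x y → |φ x - φ y| ≤ ε := by
  by_contra! hcon
  let K : ℕ → Set (Subshift A × Subshift A) := fun m =>
    {p | Agree m p.1 p.2} ∩ {p | ε ≤ |φ p.1 - φ p.2|}
  have hK : ∀ m, IsClosed (K m) := fun m => (isClosed_agree m).inter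
    (isClosed_le continuous_const ((hφ.comp continuous_fst).sub (hφ.comp continuous_snd)).abs)
  obtain ⟨p, hp⟩ := IsCompact.nonempty_iInter_of_sequence_nonempty_isCompact_isClosed K
    (fun m p hp => ⟨hp.1.mono (Nat.le_succ m), hp.2⟩)
    (fun m => by
      obtain ⟨x, y, hxy, h⟩ := hcon m
      exact ⟨(x, y), hxy, h.le⟩) (hK 0).isCompact hK
  rw [mem_iInter] at hp
  have : p.1 = p.2 := Subtype.ext (funext fun i => (hp (i + 1)).1 i (Nat.lt_succ_self i))
  have h := (hp 0).2
  simp only [mem_ofPred_eq, this, sub_self, abs_zero] at h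
  linarith

theorem tendsto_of_agree {x : ℕ → Subshift A} {y : Subshift A} (h : ∀ m, Agree m (x m) y) :
    Tendsto x atTop (𝓝 y) := by
  rw [tendsto_subtype_rng, tendsto_pi_nhds]
  intro i
  refine tendsto_const_nhds.congr' ?_
  filter_upwards [eventually_gt_atTop i] with m hm
  exact (h m i hm).symm

theorem DependsOn.mono {m n : ℕ} {V : Set (Subshift A)} (h : DependsOn m V) (hmn : m ≤ n) :
    DependsOn n V := fun x y hxy hx => h x y (hxy.mono hmn) hx

/-- Take a closed `F` inside `B` of nearly full measure. The unions of the `m`-cylinders that meet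
`F` decrease to `F`, because `F` is closed. -/
theorem exists_dependsOn_approx (ν : Measure (Subshift A)) [IsFiniteMeasure ν]
    {B : Set (Subshift A)} (hB : MeasurableSet B) {ε : ℝ} (hε : 0 < ε) :
    ∃ m C, DependsOn m C ∧ ν.real (symmDiff B C) ≤ ε := by
  obtain ⟨F, hFB, hF, hFε⟩ := hB.exists_isClosed_sdiff_lt (μ := ν) (measure_ne_top _ _)
    (ε := ENNReal.ofReal (ε / 2)) (by simpa using hε)
  let D : ℕ → Set (Subshift A) := fun m => {y | ∃ x ∈ F, Agree m x y}
  have hD : ∀ m, DependsOn m (D m) := fun m y y' hy ⟨x, hx, hxy⟩ => ⟨x, hx, hxy.trans hy⟩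
  have hFD : ∀ m, F ⊆ D m := fun m x hx => ⟨x, hx, Agree.refl m x⟩
  have hinter : ⋂ m, D m = F := by
    refine Subset.antisymm (fun y hy => ?_) (subset_iInter hFD)
    rw [mem_iInter] at hy
    choose x hx hxy using hy
    exact hF.mem_of_tendsto (tendsto_of_agree hxy) (Eventually.of_forall hx)
  have hlim := tendsto_measure_iInter_atTop (μ := ν) (s := D)
    (fun m => (hD m).isOpen.measurableSet.nullMeasurableSet)
    (fun m n hmn y ⟨x, hx, hxy⟩ => ⟨x, hx, hxy.mono hmn⟩) ⟨0, measure_ne_top _ _⟩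
  rw [hinter] at hlim
  have hlim' := (ENNReal.tendsto_toReal (measure_ne_top ν F)).comp hlim
  obtain ⟨m, hm⟩ := (hlim'.eventually (gt_mem_nhds (lt_add_of_pos_right _ (half_pos hε)))).exists
  refine ⟨m, D m, hD m, ?_⟩
  have hsub : symmDiff B (D m) ⊆ (B \ F) ∪ (D m \ F) := by
    rintro x (⟨h1, h2⟩ | ⟨h1, h2⟩)
    · exact Or.inl ⟨h1, fun hx => h2 (hFD m hx)⟩
    · exact Or.inr ⟨h1, fun hx => h2 (hFB hx)⟩
  have h1 : ν.real (B \ F) ≤ ε / 2 :=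
    ENNReal.toReal_le_of_le_ofReal (by positivity) hFε.le
  have h2 : ν.real (D m \ F) ≤ ε / 2 := by
    rw [measureReal_sdiff (hFD m) hF.measurableSet]
    have hm' : ν.real (D m) < ν.real F + ε / 2 := hm
    linarith
  exact (measureReal_mono hsub).trans ((measureReal_union_le _ _).trans (by linarith))

/-- A measurable finite partition is close to one by cylinders. -/
theorem exists_coordinate_approx (ν : Measure (Subshift A)) [IsFiniteMeasure ν] {k : ℕ} [NeZero k]
    {ξ : Subshift A → Fin k} (hξ : Measurable ξ) {ε : ℝ} (hε : 0 < ε) :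
    ∃ (m : ℕ) (ζ : Subshift A → Fin k), (∀ x y, Agree m x y → ζ x = ζ y) ∧
      ν.real {x | ξ x ≠ ζ x} ≤ ε := by
  classical
  have hk : (0 : ℝ) < k := by exact_mod_cast Nat.pos_of_ne_zero (NeZero.ne k)
  choose m C hC hν using fun a : Fin k =>
    exists_dependsOn_approx ν (hξ (measurableSet_singleton a)) (div_pos hε hk)
  let M := Finset.univ.sup m
  have hCM : ∀ a, DependsOn M (C a) := fun a => (hC a).mono (Finset.le_sup (Finset.mem_univ a))
  -- The sets `C a` may overlap or fail to cover, so `ζ` selects some index whose set contains `x`,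
  -- and 0 if there is none. A wrong choice at `x` puts `x` in one of the symmetric differences.
  let pick : Set (Fin k) → Fin k := fun S => if h : S.Nonempty then h.some else 0
  have hpick : ∀ S : Set (Fin k), S.Nonempty → pick S ∈ S := fun S hS => by
    simp only [pick, dif_pos hS]; exact hS.some_mem
  refine ⟨M, fun x => pick {a | x ∈ C a}, fun x y hxy => ?_, ?_⟩
  · have : {a | x ∈ C a} = {a | y ∈ C a} := by
      ext a
      exact Iff.intro (hCM a x y hxy) (hCM a y x hxy.symm)
    change pick {a | x ∈ C a} = pick {a | y ∈ C a}
    rw [this]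
  · have hsub : {x | ξ x ≠ pick {a | x ∈ C a}} ⊆ ⋃ a, symmDiff (ξ ⁻¹' {a}) (C a) := by
      intro x hx
      rw [mem_iUnion]
      by_cases hxC : x ∈ C (ξ x)
      · exact ⟨pick {a | x ∈ C a}, Or.inr ⟨hpick {a | x ∈ C a} ⟨_, hxC⟩, fun h => hx h⟩⟩
      · exact ⟨ξ x, Or.inl ⟨rfl, hxC⟩⟩
    refine (measureReal_mono hsub).trans ((measureReal_iUnion_fintype_le _).trans ?_)
    refine (Finset.sum_le_sum fun a _ => hν a).trans (le_of_eq ?_)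
    simp only [Finset.sum_const, Finset.card_univ, Fintype.card_fin, nsmul_eq_mul]
    field_simp

end Approximation

/-! ### Upper half of the variational principle -/

section UpperBound

variable {l : ℕ} {A : Matrix (Fin l) (Fin l) ℕ}

/-- The weight `exp φ` punctured by the hole `V`. -/
def holeWeight (φ : Subshift A → ℝ) (V : Set (Subshift A)) : Subshift A → ℝ :=
  Vᶜ.indicator fun x => Real.exp (φ x)

theorem holeWeight_nonneg (φ : Subshift A → ℝ) (V : Set (Subshift A)) : 0 ≤ holeWeight φ V :=
  fun x => indicator_nonneg (fun _ _ => Real.exp_nonneg _) x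

theorem continuous_holeWeight {φ : Subshift A → ℝ} (hφ : Continuous φ) {q : ℕ}
    {V : Set (Subshift A)} (hV : DependsOn q V) : Continuous (holeWeight φ V) :=
  (Real.continuous_exp.comp hφ).indicator (by simp [hV.compl.isClopen.frontier_eq])

theorem integral_comp_shift_iterate {ν : Measure (Subshift A)} (hν : MeasurePreserving shift ν ν)
    {g : Subshift A → ℝ} (hg : Integrable g ν) (i : ℕ) :
    ∫ x, g (shift^[i] x) ∂ν = ∫ x, g x ∂ν := by
  have h := hν.iterate i
  rw [← integral_map h.measurable.aemeasurable (by rw [h.map_eq]; exact hg.aestronglyMeasurable),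
    h.map_eq]

theorem survivor_iff {V : Set (Subshift A)} {x : Subshift A} :
    x ∈ survivor V ↔ ∀ i, shift^[i] x ∉ V := by
  simp [survivor]

variable {φ : Subshift A → ℝ} {V : Set (Subshift A)} {q : ℕ}

/-- The functions `c a` form a code: subprobability weights for the symbols of `ξ`, read off from
the first `m + 1` coordinates. Admitting a code lets an arbitrary partition `ξ` be treated directly,
at the price of the expected code length, instead of reducing to the partition by the first
coordinate. -/
theorem partitionEntropy_itinerary_le [Nonempty (Subshift A)] (hV : DependsOn q V)
    (hφc : Continuous φ)
    {ν : Measure (Subshift A)} [IsProbabilityMeasure ν] (hinv : MeasurePreserving shift ν ν)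
    (hsurv : ∀ᵐ x ∂ν, x ∈ survivor V) {k m : ℕ} {ξ : Subshift A → Fin k} (hξ : Measurable ξ)
    (hqm : q ≤ m + 1) {ε : ℝ} (hφ : ∀ x y, Agree (m + 1) x y → |φ x - φ y| ≤ ε)
    {c : Fin k → Subshift A → ℝ} (hc0 : ∀ a x, 0 < c a x) (hc1 : ∀ x, ∑ a, c a x ≤ 1)
    (hc : ∀ a x y, Agree (m + 1) x y → c a x = c a y)
    (hκ : Integrable (fun x => -Real.log (c (ξ x) x)) ν) {C s : ℝ} (hC : 0 < C) (hs : 0 < s)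
    (n : ℕ) (hL : ∀ x, (op (holeWeight φ V) ^ n) 1 x ≤ C * s ^ n) :
    partitionEntropy ν (fun x => fun i : Fin n => ξ (shift^[i] x)) ≤
      Real.log ((Fintype.card (Fin (m + 1) → Fin l) : ℕ) * C) + n * (Real.log s + ε - ∫ x, φ x ∂ν +
        ∫ x, -Real.log (c (ξ x) x) ∂ν) := by
  classical
  set G := holeWeight φ V
  have hG : 0 ≤ G := holeWeight_nonneg φ V
  obtain ⟨R, hR⟩ := exists_representatives (A := A) (m + 1)
  obtain ⟨x0⟩ := (inferInstance : Nonempty (Subshift A))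
  have : Nonempty (Fin (m + 1) → Fin l) := ⟨fun i => x0.1 i⟩
  set K : ℝ := ((Fintype.card (Fin (m + 1) → Fin l) : ℕ) : ℝ)
  have hK : 0 < K := Nat.cast_pos.2 Fintype.card_pos
  have hφi : Integrable φ ν := by
    obtain ⟨M, -, hM⟩ := exists_bound hφc
    exact Integrable.of_bound hφc.aestronglyMeasurable M (Eventually.of_forall hM)
  let F : (Fin n → Fin k) → Subshift A → ℝ := fun s y => ∏ i : Fin n, c (s i) (shift^[i] y)
  have hF : ∀ s, 0 ≤ F s := fun s y => Finset.prod_nonneg fun i _ => (hc0 _ _).le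
  have hW : 0 < K * C * s ^ n := by positivity
  -- Reference weights for the Gibbs inequality. Their sum is at most 1 because the products `F s'`
  -- add up to at most 1 and the iterates on 1 are at most `C s^n` at each of the `K`
  -- representatives.
  let Q : (Fin n → Fin k) → ℝ := fun s' => (K * C * s ^ n)⁻¹ * ∑ u, (op G ^ n) (F s') (R u)
  let b : Subshift A → ℝ := fun x => Real.log (K * C) + n * (Real.log s + ε) -
    ∑ i ∈ Finset.range n, φ (shift^[i] x) +
    ∑ i ∈ Finset.range n, -Real.log (c (ξ (shift^[i] x)) (shift^[i] x))
  have hQ : ∀ s', 0 ≤ Q s' := fun s' => mul_nonneg (inv_nonneg.2 hW.le)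
    (Finset.sum_nonneg fun u _ => op_pow_nonneg hG (hF s') n _)
  have hQ1 : ∑ s', Q s' ≤ 1 := by
    have h1 : ∑ s', F s' ≤ 1 := fun y => by
      rw [Finset.sum_apply]
      change ∑ s' : Fin n → Fin k, ∏ i : Fin n, c (s' i) (shift^[i] y) ≤ 1
      rw [← Fintype.prod_sum (fun (i : Fin n) a => c a (shift^[i] y))]
      exact Finset.prod_le_one (fun i _ => Finset.sum_nonneg fun a _ => (hc0 _ _).le)
        fun i _ => hc1 _
    have h2 : ∑ s', ∑ u, (op G ^ n) (F s') (R u) ≤ K * (C * s ^ n) := by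
      rw [Finset.sum_comm]
      refine (Finset.sum_le_sum (g := fun _ => C * s ^ n) fun u _ => ?_).trans (by simp [K])
      rw [← Finset.sum_apply, ← map_sum]
      exact (op_pow_le_op_pow hG h1 n (R u)).trans (hL _)
    rw [← Finset.mul_sum, inv_mul_le_iff₀ hW]
    linarith
  have hb : Integrable b ν := by
    refine ((integrable_const _).sub (integrable_finsetSum _ fun i _ => ?_)).add
      (integrable_finsetSum _ fun i _ => ?_)
    · exact (hinv.iterate i).integrable_comp_of_integrable hφi
    · exact (hinv.iterate i).integrable_comp_of_integrable hκ
  have hbQ : ∀ᵐ x ∂ν, Real.exp (-b x) ≤ Q (fun i : Fin n => ξ (shift^[i] x)) := by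
    filter_upwards [hsurv] with x hx
    rw [survivor_iff] at hx
    have hRx := hR (shift^[n] x)
    set u := fun i : Fin (m + 1) => (shift^[n] x).1 i
    -- The point `y` follows `x` for `n + m + 1` symbols and lands on a representative. It therefore
    -- avoids the hole and has the same code weights during the first `n` steps, and its Birkhoff
    -- sum differs from that of `x` by at most `n ε`.
    obtain ⟨y, hy, hyx⟩ := exists_glue n m x (R u) hRx
    have hag : ∀ i < n, Agree (m + 1) (shift^[i] x) (shift^[i] y) := fun i hi =>
      Agree.shift_iterate (hyx.symm.mono (by omega))
    have h1 := le_op_pow_shift hG (hF fun i : Fin n => ξ (shift^[i] x)) n y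
    rw [hy] at h1
    have h2 := h1.trans (Finset.single_le_sum (f := fun u => (op G ^ n)
      (F fun i : Fin n => ξ (shift^[i] x)) (R u)) (fun u _ => op_pow_nonneg hG (hF _) n _)
      (Finset.mem_univ u))
    have h3 : ∏ i ∈ Finset.range n, Real.exp (φ (shift^[i] x) - ε) ≤
        ∏ i ∈ Finset.range n, G (shift^[i] y) := by
      refine Finset.prod_le_prod (fun i _ => Real.exp_nonneg _) fun i hi => ?_
      have hi' := hag i (Finset.mem_range.1 hi)
      have hnot : shift^[i] y ∈ Vᶜ := fun hyV => hx i (hV _ _ (hi'.symm.mono hqm) hyV)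
      rw [show G (shift^[i] y) = Real.exp (φ (shift^[i] y)) from indicator_of_mem hnot _,
        Real.exp_le_exp]
      linarith [(abs_le.1 (hφ _ _ hi')).2]
    have h4 : F (fun i : Fin n => ξ (shift^[i] x)) y =
        ∏ i ∈ Finset.range n, c (ξ (shift^[i] x)) (shift^[i] x) := by
      rw [← Fin.prod_univ_eq_prod_range (fun i => c (ξ (shift^[i] x)) (shift^[i] x)) n]
      exact Finset.prod_congr rfl fun i _ => (hc _ _ _ (hag i i.2)).symm
    change _ ≤ (K * C * s ^ n)⁻¹ * _
    rw [le_inv_mul_iff₀ hW]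
    refine le_trans (le_of_eq ?_) ((mul_le_mul_of_nonneg_right h3 (hF _ y)).trans h2)
    rw [h4, ← Real.exp_sum]
    have h5 : ∏ i ∈ Finset.range n, c (ξ (shift^[i] x)) (shift^[i] x) = Real.exp (
        -∑ i ∈ Finset.range n, -Real.log (c (ξ (shift^[i] x)) (shift^[i] x))) := by
      rw [Finset.sum_neg_distrib, neg_neg, Real.exp_sum]
      exact Finset.prod_congr rfl fun i _ => (Real.exp_log (hc0 _ _)).symm
    have h6 : K * C * s ^ n = Real.exp (Real.log (K * C) + n * Real.log s) := by
      rw [Real.exp_add, Real.exp_log (by positivity), mul_comm (n : ℝ), Real.exp_mul,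
        Real.exp_log hs, Real.rpow_natCast]
    rw [h5, h6, ← Real.exp_add, ← Real.exp_add]
    congr 1
    simp only [b, Finset.sum_sub_distrib, Finset.sum_const, Finset.card_range, nsmul_eq_mul]
    ring
  have hmeas : Measurable (fun x => fun i : Fin n => ξ (shift^[i] x)) :=
    measurable_pi_lambda _ fun i => hξ.comp (hinv.iterate i).measurable
  refine (partitionEntropy_le_integral hmeas hQ hQ1 hb hbQ).trans (le_of_eq ?_)
  have hi1 : ∀ i, Integrable (fun x => φ (shift^[i] x)) ν := fun i =>
    (hinv.iterate i).integrable_comp_of_integrable hφi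
  have hi2 : ∀ i, Integrable (fun x => -Real.log (c (ξ (shift^[i] x)) (shift^[i] x))) ν := fun i =>
    (hinv.iterate i).integrable_comp_of_integrable hκ
  have e1 : ∫ x, ∑ i ∈ Finset.range n, φ (shift^[i] x) ∂ν = n * ∫ x, φ x ∂ν := by
    rw [integral_finsetSum _ fun i _ => hi1 i]
    simp [integral_comp_shift_iterate hinv hφi]
  have e2 : ∫ x, ∑ i ∈ Finset.range n, -Real.log (c (ξ (shift^[i] x)) (shift^[i] x)) ∂ν =
      n * ∫ x, -Real.log (c (ξ x) x) ∂ν := by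
    rw [integral_finsetSum _ fun i _ => hi2 i]
    rw [Finset.sum_congr rfl fun i _ => integral_comp_shift_iterate hinv hκ i]
    simp
  simp only [b]
  rw [integral_add, integral_sub, e1, e2]
  · simp only [integral_const, probReal_univ, smul_eq_mul]
    ring
  · exact integrable_const _
  · exact integrable_finsetSum _ fun i _ => hi1 i
  · exact (integrable_const _).sub (integrable_finsetSum _ fun i _ => hi1 i)
  · exact integrable_finsetSum _ fun i _ => hi2 i

theorem entropyRel_le_of_bound {ν : Measure (Subshift A)} {k : ℕ} {ξ : Subshift A → Fin k}
    {a b : ℝ} (h : ∀ n, partitionEntropy ν (fun x => fun i : Fin n => ξ (shift^[i] x)) ≤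
      a + n * b) : entropyRel ν shift ξ ≤ (b : EReal) := by
  have hlim : Tendsto (fun n : ℕ => ((a / n + b : ℝ) : EReal)) atTop (𝓝 (b : EReal)) := by
    refine (continuous_coe_real_ereal.tendsto b).comp ?_
    simpa using (tendsto_const_div_atTop_nhds_zero_nat a).add_const b
  rw [← hlim.limsup_eq]
  refine limsup_le_limsup ?_
  filter_upwards [eventually_gt_atTop 0] with n hn
  have hn' : (0 : ℝ) < n := by exact_mod_cast hn
  rw [EReal.coe_le_coe_iff, div_le_iff₀ hn']
  refine (h n).trans (le_of_eq ?_)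
  field_simp

/-- Codes with small expected length, adapted to a partition by finitely many coordinates. -/
theorem exists_code (ν : Measure (Subshift A)) [IsProbabilityMeasure ν] {k : ℕ} [NeZero k]
    {ξ : Subshift A → Fin k} (hξ : Measurable ξ) {η : ℝ} (hη : 0 < η) :
    ∃ (m : ℕ) (c : Fin k → Subshift A → ℝ), (∀ a x, 0 < c a x) ∧ (∀ x, ∑ a, c a x ≤ 1) ∧
      (∀ a x y, Agree m x y → c a x = c a y) ∧
      Integrable (fun x => -Real.log (c (ξ x) x)) ν ∧ ∫ x, -Real.log (c (ξ x) x) ∂ν ≤ η := by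
  classical
  have hk1 : (1 : ℝ) ≤ k := by exact_mod_cast Nat.pos_of_ne_zero (NeZero.ne k)
  have hk : (0 : ℝ) < k := by linarith
  -- A correctly predicted symbol receives weight `1 - δ`, hence code length exactly `η / 2`; a
  -- wrongly predicted one receives `δ / k`, hence length `L`.
  set δ := 1 - Real.exp (-(η / 2)) with hδ
  have hδ1 : δ < 1 := by have := Real.exp_pos (-(η / 2)); linarith
  have hδ0 : 0 < δ := by
    have : Real.exp (-(η / 2)) < 1 := by
      rw [← Real.exp_zero]; exact Real.exp_lt_exp.2 (by linarith)
    linarith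
  set L := -Real.log (δ / k)
  have hL : 0 ≤ L := by
    have : Real.log (δ / k) ≤ 0 := Real.log_nonpos (by positivity)
      ((div_le_one hk).2 (by linarith))
    linarith
  -- The prediction `ζ` errs with probability so small that errors of length `L` cost at most `η /
  -- 2` on average.
  obtain ⟨m, ζ, hζ, hν⟩ := exists_coordinate_approx ν hξ (ε := η / (2 * (L + 1))) (by positivity)
  have hζm : Measurable ζ := by
    refine measurable_to_countable' fun a => ?_
    have : DependsOn m (ζ ⁻¹' {a}) := fun x y hxy hx => by
      rw [mem_preimage, ← hζ x y hxy]; exact hx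
    exact this.isOpen.measurableSet
  let c : Fin k → Subshift A → ℝ := fun a x => if a = ζ x then 1 - δ else δ / k
  have hval : ∀ x, -Real.log (c (ξ x) x) = if ξ x = ζ x then η / 2 else L := fun x => by
    simp only [c]
    split_ifs
    · rw [hδ, sub_sub_cancel, Real.log_exp, neg_neg]
    · rfl
  have hE : MeasurableSet {x | ξ x ≠ ζ x} := (measurableSet_eq_fun hξ hζm).compl
  have hint : Integrable (fun x => -Real.log (c (ξ x) x)) ν := by
    simp only [hval]
    refine Integrable.of_bound (C := η / 2 + L) (Measurable.aestronglyMeasurable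
      (Measurable.ite (measurableSet_eq_fun hξ hζm) measurable_const measurable_const))
      (Eventually.of_forall fun x => ?_)
    rw [Real.norm_eq_abs]
    split_ifs
    · rw [abs_of_pos (by positivity)]; linarith
    · rw [abs_of_nonneg hL]; linarith
  refine ⟨m, c, fun a x => ?_, fun x => ?_, fun a x y hxy => ?_, hint, ?_⟩
  · simp only [c]
    split_ifs
    · linarith
    · positivity
  · refine (Finset.sum_le_sum (g := fun a => (if a = ζ x then 1 - δ else 0) + δ / k)
      fun a _ => ?_).trans (le_of_eq ?_)
    · simp only [c]
      split_ifs
      · have : 0 < δ / k := by positivity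
        linarith
      · simp
    · rw [Finset.sum_add_distrib, Finset.sum_ite_eq']
      simp only [Finset.mem_univ, if_true, Finset.sum_const, Finset.card_univ, Fintype.card_fin,
        nsmul_eq_mul]
      field_simp
      ring
  · simp only [c, hζ x y hxy]
  · have h1 : ∫ x, -Real.log (c (ξ x) x) ∂ν ≤
        ∫ x, (η / 2 + {x | ξ x ≠ ζ x}.indicator (fun _ => L) x) ∂ν := by
      refine integral_mono hint ((integrable_const _).add ((integrable_const L).indicator hE))
        fun x => ?_
      simp only [hval]
      by_cases hx : ξ x = ζ x
      · simp [hx]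
      · simp only [hx, if_false]
        rw [indicator_of_mem (by exact hx)]
        linarith
    refine h1.trans ?_
    rw [integral_add (integrable_const _) ((integrable_const L).indicator hE),
      integral_indicator hE, setIntegral_const]
    simp only [integral_const, probReal_univ, smul_eq_mul, one_mul]
    have h2 : ν.real {x | ξ x ≠ ζ x} * L ≤ η / (2 * (L + 1)) * L :=
      mul_le_mul_of_nonneg_right hν hL
    have h3 : η / (2 * (L + 1)) * L ≤ η / 2 := by
      rw [div_mul_eq_mul_div, div_le_div_iff₀ (by positivity) (by positivity)]
      nlinarith
    linarith

/-- The upper half of the variational principle on a survivor set. -/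
theorem ksEntropy_le (hV : DependsOn q V) (hφ : Continuous φ) {s : ℝ}
    (hs : s ∈ growthRates (holeWeight φ V)) {ν : Measure (Subshift A)} [IsProbabilityMeasure ν]
    (hinv : MeasurePreserving shift ν ν) (hsurv : ∀ᵐ x ∂ν, x ∈ survivor V) :
    ksEntropy ν shift ≤ ((Real.log s - ∫ x, φ x ∂ν : ℝ) : EReal) := by
  obtain ⟨hs0, C, hC, hL⟩ := hs
  have hne : Nonempty (Subshift A) := ν.nonempty_of_neZero
  refine iSup_le fun k => iSup_le fun ξ => iSup_le fun hξ => ?_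
  have : NeZero k := ⟨by rintro rfl; exact (ξ hne.some).elim0⟩
  refine EReal.le_of_forall_lt_iff_le.1 fun z hz => ?_
  rw [EReal.coe_lt_coe_iff] at hz
  -- Half of the gap is spent on the modulus of continuity of `φ`, the other half on the code.
  set η := (z - (Real.log s - ∫ x, φ x ∂ν)) / 2 with hηdef
  have hη : 0 < η := by linarith
  obtain ⟨m1, c, hc0, hc1, hc, hκ, hκη⟩ := exists_code ν hξ hη
  obtain ⟨m2, hm2⟩ := exists_agree_modulus hφ hη
  set m := m1 + m2 + q
  have h := entropyRel_le_of_bound (ν := ν) (ξ := ξ) fun n =>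
    partitionEntropy_itinerary_le hV hφ hinv hsurv hξ (m := m) (by omega)
      (fun x y hxy => hm2 x y (hxy.mono (by omega))) hc0 hc1
      (fun a x y hxy => hc a x y (hxy.mono (by omega))) hκ hC hs0 n (hL n)
  refine h.trans (EReal.coe_le_coe_iff.2 ?_)
  linarith

end UpperBound

/-! ### Limits of positive functionals and a lower entropy bound -/

section LimitMeasure

variable {X : Type*} [TopologicalSpace X] [CompactSpace X] [T2Space X] [MeasurableSpace X]
  [BorelSpace X]

/-- Normalised positive functionals on a compact space accumulate at a probability measure. -/
theorem exists_limit_measure (w : ℕ → C(X, ℝ) →ₗ[ℝ] ℝ) (hpos : ∀ n f, 0 ≤ f → 0 ≤ w n f)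
    (hone : ∀ n, w n 1 = 1) : ∃ (ν : Measure X) (𝒰 : Ultrafilter ℕ), IsProbabilityMeasure ν ∧
      (𝒰 : Filter ℕ) ≤ atTop ∧ ∀ f : C(X, ℝ), Tendsto (fun n => w n f) 𝒰 (𝓝 (∫ x, f x ∂ν)) := by
  let 𝒰 : Ultrafilter ℕ := Ultrafilter.of atTop
  have hmono : ∀ n f g, f ≤ g → w n f ≤ w n g := fun n f g hfg => by
    have := hpos n (g - f) (sub_nonneg.2 hfg)
    rw [map_sub] at this
    linarith
  have hbd : ∀ n f, w n f ∈ Icc (-‖f‖) ‖f‖ := fun n f => by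
    have hc : ∀ r : ℝ, w n (r • 1) = r := fun r => by rw [map_smul, hone, smul_eq_mul, mul_one]
    constructor
    · rw [← hc (-‖f‖)]
      refine hmono n _ _ fun x => ?_
      simpa using (abs_le.1 (f.norm_coe_le_norm x)).1
    · rw [← hc ‖f‖]
      refine hmono n _ _ fun x => ?_
      simpa using (abs_le.1 (f.norm_coe_le_norm x)).2
  have hlim : ∀ f : C(X, ℝ), ∃ a, Tendsto (fun n => w n f) 𝒰 (𝓝 a) := fun f => by
    obtain ⟨a, -, ha⟩ := isCompact_Icc.ultrafilter_le_nhds (𝒰.map fun n => w n f)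
      (by
        rw [le_principal_iff]
        exact Filter.Eventually.of_forall (f := (𝒰 : Filter ℕ))
          (p := fun n => w n f ∈ Icc (-‖f‖) ‖f‖) fun n => hbd n f)
    exact ⟨a, ha⟩
  choose Λ hΛ using hlim
  -- On a compact space every continuous function has compact support, so Riesz–Markov applies to
  -- the limit functional.
  let Λ' : CompactlySupportedContinuousMap X ℝ →ₚ[ℝ] ℝ := PositiveLinearMap.mk
    { toFun := fun f => Λ f.toContinuousMap
      map_add' := fun f g => tendsto_nhds_unique (hΛ _) (by
        have := (hΛ f.toContinuousMap).add (hΛ g.toContinuousMap)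
        simp only [← map_add] at this
        exact this)
      map_smul' := fun c f => tendsto_nhds_unique (hΛ _) (by
        have := (hΛ f.toContinuousMap).const_mul c
        simp only [← smul_eq_mul, ← map_smul] at this
        exact this) }
    (fun f g hfg => le_of_tendsto_of_tendsto' (hΛ _) (hΛ _) fun n => hmono n _ _ hfg)
  have hint : ∀ f : C(X, ℝ), ∫ x, f x ∂(RealRMK.rieszMeasure Λ') = Λ f := fun f =>
    RealRMK.integral_rieszMeasure Λ' (CompactlySupportedContinuousMap.continuousMapEquiv f)
  refine ⟨RealRMK.rieszMeasure Λ', 𝒰, ⟨?_⟩, Ultrafilter.of_le _, fun f => hint f ▸ hΛ f⟩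
  have h1 : Λ 1 = 1 := tendsto_nhds_unique (hΛ 1) (by simp only [hone]; exact tendsto_const_nhds)
  have h2 := hint 1
  simp only [ContinuousMap.one_apply, integral_const, smul_eq_mul, mul_one, h1,
    measureReal_def] at h2
  rw [← ENNReal.toReal_eq_one_iff]
  exact h2

/-- Lower bound for the entropy of a partition by an integrated information function. -/
theorem integral_le_partitionEntropy {X ι : Type*} [MeasurableSpace X] [Fintype ι]
    [MeasurableSpace ι] [MeasurableSingletonClass ι] {μ : Measure X} [IsProbabilityMeasure μ]
    {f : X → ι} (hf : Measurable f) {b : X → ℝ} (hb : Integrable b μ)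
    (h : ∀ x, μ.real (f ⁻¹' {f x}) ≤ Real.exp (-b x)) :
    ∫ x, b x ∂μ ≤ partitionEntropy μ f := by
  classical
  have hS : ∀ a, MeasurableSet (f ⁻¹' {a}) := fun a => hf (measurableSet_singleton a)
  rw [integral_eq_sum_fibres hf hb, partitionEntropy]
  refine Finset.sum_le_sum fun a _ => ?_
  by_cases hne : μ (f ⁻¹' {a}) = 0
  · rw [setIntegral_measure_zero _ hne, measureReal_def, hne]
    simp
  · have hpos : 0 < μ.real (f ⁻¹' {a}) := ENNReal.toReal_pos hne (measure_ne_top _ _)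
    have h1 : ∫ _ in f ⁻¹' {a}, (-Real.log (μ.real (f ⁻¹' {a}))) ∂μ =
        Real.negMulLog (μ.real (f ⁻¹' {a})) := by
      rw [setIntegral_const, smul_eq_mul, Real.negMulLog]
      ring
    rw [← h1]
    refine setIntegral_mono_on hb.integrableOn integrableOn_const (hS a) fun x hx => ?_
    have h2 := h x
    rw [show f x = a from hx] at h2
    have := (Real.log_le_iff_le_exp hpos).2 h2
    linarith

end LimitMeasure

/-! ### Gibbs measures on survivor sets and the variational principle -/

section LowerBound

variable {l : ℕ} {A : Matrix (Fin l) (Fin l) ℕ}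

theorem isClosed_survivor {V : Set (Subshift A)} (hV : IsOpen V) : IsClosed (survivor V) :=
  isClosed_iInter fun i => (hV.preimage (continuous_shift.iterate i)).isClosed_compl

/-- Hölder continuity with respect to the number of common coordinates. -/
def IsAgreeHolder (θ C : ℝ) (φ : Subshift A → ℝ) : Prop :=
  ∀ m x y, Agree m x y → |φ x - φ y| ≤ C * θ ^ m

theorem IsAgreeHolder.logHolder {θ C : ℝ} {φ : Subshift A → ℝ} (h : IsAgreeHolder θ C φ)
    {V : Set (Subshift A)} {q : ℕ} (hV : DependsOn q V) : LogHolder θ C q (holeWeight φ V) where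
  nonneg := holeWeight_nonneg φ V
  le_mul m hm x y hxy := by
    rw [holeWeight]
    by_cases hx : x ∈ V
    · have hy : y ∈ V := hV x y (hxy.mono hm) hx
      simp [hx, hy]
    · have hy : y ∉ V := fun hy => hx (hV y x (hxy.mono hm).symm hy)
      rw [indicator_of_mem (by exact hx), indicator_of_mem (by exact hy), ← Real.exp_add,
        Real.exp_le_exp]
      linarith [(abs_le.1 (h m x y hxy)).2]

theorem IsAgreeHolder.continuous {θ C : ℝ} {φ : Subshift A → ℝ} (hθ : 0 < θ) (hθ' : θ < 1)
    (h : IsAgreeHolder θ C φ) : Continuous φ := by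
  have h1 := (h.logHolder (dependsOn_empty 0)).continuous hθ hθ'
  have h2 : φ = fun x => Real.log (holeWeight φ ∅ x) := by
    funext x; simp [holeWeight]
  rw [h2]
  exact h1.log fun x => by simp [holeWeight]

/-- At most one inverse branch of the `n`-th iterate lands in a given `n`-cylinder. Along it the
values of `φ` differ from those on the orbit of `y` by geometrically small amounts, which sum to a
bounded distortion. -/
theorem op_pow_indicator_cylinder_le {θ C : ℝ} {φ : Subshift A → ℝ} (h : IsAgreeHolder θ C φ)
    (V : Set (Subshift A)) (n : ℕ) (y : Subshift A) {f : Subshift A → ℝ} {H : ℝ} (hf : 0 ≤ f)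
    (hfH : ∀ x ∈ cylinder y n, f x ≤ H) (hH : 0 ≤ H) (x : Subshift A) :
    (op (holeWeight φ V) ^ n) ((cylinder y n).indicator f) x ≤
      H * Real.exp (∑ i ∈ Finset.range n, φ (shift^[i] y) +
        C * ∑ i ∈ Finset.range n, θ ^ (i + 1)) := by
  classical
  induction n generalizing y f H with
  | zero =>
    refine (show (cylinder y 0).indicator f x ≤ _ from ?_)
    rw [indicator_of_mem (show x ∈ cylinder y 0 from fun i hi => absurd hi (Nat.not_lt_zero i))]
    simpa using hfH x (fun i hi => absurd hi (Nat.not_lt_zero i))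
  | succ n ih =>
    rw [op_pow_succ]
    set G := holeWeight φ V
    have hG : 0 ≤ G := holeWeight_nonneg φ V
    set F := (cylinder y (n + 1)).indicator f
    have hF : 0 ≤ F := fun x => indicator_nonneg (fun _ _ => hf _) x
    set H' := Real.exp (φ y + C * θ ^ (n + 1)) * H with hH'
    have hb : ∀ x, op G F x ≤ H' := by
      intro x
      rw [op_apply, Finset.sum_eq_single (y.1 0)]
      · split_ifs with ha
        · by_cases hx : pre (y.1 0) x ∈ cylinder y (n + 1)
          · rw [show F (pre (y.1 0) x) = f (pre (y.1 0) x) from indicator_of_mem hx f]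
            refine mul_le_mul ?_ (hfH _ hx) (hf _) (Real.exp_nonneg _)
            refine (indicator_le_self' (fun _ _ => Real.exp_nonneg _) _).trans ?_
            rw [Real.exp_le_exp]
            linarith [(abs_le.1 (h _ _ _ hx)).2]
          · rw [show F (pre (y.1 0) x) = 0 from indicator_of_notMem hx f, mul_zero]
            positivity
        · positivity
      · intro a _ ha
        split_ifs with hax
        · rw [show F (pre a x) = 0 from indicator_of_notMem (fun hx => ha ?_) f, mul_zero]
          have := hx 0 (Nat.succ_pos n)
          rwa [pre_zero hax] at this
        · rfl
      · intro hn
        exact absurd (Finset.mem_univ _) hn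
    have hs : op G F = (cylinder (shift y) n).indicator (op G F) := by
      funext x
      by_cases hx : x ∈ cylinder (shift y) n
      · rw [indicator_of_mem hx]
      · rw [indicator_of_notMem hx, op_apply]
        refine Finset.sum_eq_zero fun a _ => ?_
        split_ifs with hax
        · rw [show F (pre a x) = 0 from indicator_of_notMem (fun hx' => hx ?_) f, mul_zero]
          intro i hi
          have := hx' (i + 1) (by omega)
          rwa [pre_succ hax] at this
        · rfl
    rw [hs]
    refine (ih (shift y) (op_nonneg hG hF) (fun x _ => hb x) (by positivity)).trans (le_of_eq ?_)
    rw [hH', mul_right_comm, ← Real.exp_add, mul_comm]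
    congr 2
    rw [Finset.sum_range_succ' (fun i => φ (shift^[i] y)), Finset.sum_range_succ (fun i => θ ^ (i + 1))]
    simp only [Function.iterate_succ_apply, Function.iterate_zero, id]
    ring

theorem sum_pow_le {θ : ℝ} (hθ : 0 < θ) (hθ' : θ < 1) (n : ℕ) :
    ∑ i ∈ Finset.range n, θ ^ (i + 1) ≤ (1 - θ)⁻¹ := by
  rw [← tsum_geometric_of_lt_one hθ.le hθ']
  refine le_trans (Finset.sum_le_sum fun i _ => ?_) ((summable_geometric_of_lt_one hθ.le
    hθ').sum_le_tsum (Finset.range n) fun i _ => by positivity)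
  exact pow_le_pow_of_le_one hθ.le hθ'.le (Nat.le_succ i)

variable {θ B C r : ℝ} {q : ℕ} {φ h : Subshift A → ℝ} {V : Set (Subshift A)}

/-- The Gibbs estimate for iterates of an eigenfunction cut off to a cylinder. -/
theorem exists_op_pow_cylinder_le [Nonempty (Subshift A)] (hθ : 0 < θ) (hθ' : θ < 1) (hC : 0 ≤ C)
    (hφ : IsAgreeHolder θ C φ) (hh : LogHolder θ B q h)
    (he : op (holeWeight φ V) h = r • h) :
    ∃ K, 0 < K ∧ ∀ n y, (op (holeWeight φ V) ^ n) ((cylinder y n).indicator h) ≤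
      (K * Real.exp (∑ i ∈ Finset.range n, φ (shift^[i] y))) • h := by
  obtain ⟨M, hM, hhM⟩ := exists_bound (hh.continuous hθ hθ')
  obtain ⟨c, hc, hch⟩ := hh.exists_lower_bound
  refine ⟨M * Real.exp (C * (1 - θ)⁻¹) / c, by positivity, fun n y x => ?_⟩
  have hG := holeWeight_nonneg φ V
  -- At a zero of `h` the iterate of the cut-off function is at most `r^n h x = 0`; elsewhere `h` is
  -- bounded below.
  by_cases hx : h x = 0
  · have h1 := op_pow_le_op_pow hG (f := (cylinder y n).indicator h) (g := h)
      (fun x => indicator_le_self' (fun _ _ => hh.nonneg _) x) n x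
    rw [op_eigen_pow he] at h1
    simpa [hx] using h1
  · have h1 := op_pow_indicator_cylinder_le hφ V n y hh.nonneg
      (fun x _ => (le_abs_self _).trans (hhM x)) hM.le x
    refine h1.trans ?_
    have h2 : C * ∑ i ∈ Finset.range n, θ ^ (i + 1) ≤ C * (1 - θ)⁻¹ :=
      mul_le_mul_of_nonneg_left (sum_pow_le hθ hθ' n) hC
    rw [Real.exp_add]
    set S := Real.exp (∑ i ∈ Finset.range n, φ (shift^[i] y))
    have hS : 0 < S := Real.exp_pos _
    have h3 : M * (S * Real.exp (C * ∑ i ∈ Finset.range n, θ ^ (i + 1))) ≤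
        M * (S * Real.exp (C * (1 - θ)⁻¹)) := by
      have := Real.exp_le_exp.2 h2
      gcongr
    refine h3.trans ?_
    have h4 : M * Real.exp (C * (1 - θ)⁻¹) / c * S * c ≤
        M * Real.exp (C * (1 - θ)⁻¹) / c * S * h x :=
      mul_le_mul_of_nonneg_left (hch x hx) (by positivity)
    refine le_trans (le_of_eq ?_) h4
    field_simp

/-- An eigenfunction of the punctured operator gives an invariant Gibbs measure on the survivor
set. -/
theorem exists_gibbs_measure (hθ : 0 < θ) (hθ' : θ < 1) (hC : 0 ≤ C)
    (hφ : IsAgreeHolder θ C φ) (hV : DependsOn q V) (hh : LogHolder θ B q h)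
    (he : op (holeWeight φ V) h = r • h) (hr : 0 < r) {x0 : Subshift A} (hx0 : 0 < h x0) :
    ∃ (ν : Measure (Subshift A)) (K : ℝ), IsProbabilityMeasure ν ∧ MeasurePreserving shift ν ν ∧
      ν V = 0 ∧ 0 < K ∧ ∀ n y, ν.real (cylinder y n) ≤
        K * Real.exp (∑ i ∈ Finset.range n, φ (shift^[i] y)) * (r ^ n)⁻¹ := by
  have : Nonempty (Subshift A) := ⟨x0⟩
  obtain ⟨K, hK, hKcyl⟩ := exists_op_pow_cylinder_le hθ hθ' hC hφ hh he
  set G := holeWeight φ V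
  have hG : 0 ≤ G := holeWeight_nonneg φ V
  have hrn : ∀ n, 0 < (r ^ n)⁻¹ := fun n => by positivity
  -- The `i`-th iterate at `x0`, normalised by the eigenfunction. The eigenvalue equation gives `W i
  -- 1 = 1`, and pulling out `f ∘ σ` gives `W (i + 1) (f ∘ σ) = W i f`. A Cesàro limit is therefore
  -- invariant, without first constructing an eigenmeasure of the dual operator.
  let W : ℕ → C(Subshift A, ℝ) →ₗ[ℝ] ℝ := fun i =>
    { toFun := fun f => (r ^ i)⁻¹ * (op G ^ i) (fun x => h x * f x) x0 / h x0
      map_add' := fun f g => by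
        have : (fun x => h x * (f + g) x) = (fun x => h x * f x) + fun x => h x * g x := by
          funext x; simp [mul_add]
        rw [this, map_add, Pi.add_apply]
        ring
      map_smul' := fun c f => by
        have : (fun x => h x * (c • f) x) = c • fun x => h x * f x := by
          funext x; simp [mul_left_comm]
        rw [this, map_smul, Pi.smul_apply, smul_eq_mul, smul_eq_mul, RingHom.id_apply]
        ring }
  have hW : ∀ i f, W i f = (r ^ i)⁻¹ * (op G ^ i) (fun x => h x * f x) x0 / h x0 := fun i f => rfl
  have hWpos : ∀ i f, 0 ≤ f → 0 ≤ W i f := fun i f hf => by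
    rw [hW]
    exact div_nonneg (mul_nonneg (hrn i).le (op_pow_nonneg hG
      (fun x => mul_nonneg (hh.nonneg x) (hf x)) i x0)) hx0.le
  have hWone : ∀ i, W i 1 = 1 := fun i => by
    rw [hW]
    simp only [ContinuousMap.one_apply, mul_one]
    rw [op_eigen_pow he]
    simp only [Pi.smul_apply, smul_eq_mul]
    field_simp
  let σ : C(Subshift A, Subshift A) := ⟨shift, continuous_shift⟩
  have hWshift : ∀ i (f : C(Subshift A, ℝ)), W (i + 1) (f.comp σ) = W i f := fun i f => by
    rw [hW, hW, op_pow_succ]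
    have : op G (fun x => h x * (f.comp σ) x) = r • fun x => h x * f x := by
      have h1 := op_mul_comp_shift G h f
      rw [he] at h1
      refine Eq.trans h1 ?_
      funext x
      simp [mul_assoc]
    rw [this, map_smul, Pi.smul_apply, smul_eq_mul, pow_succ]
    field_simp
  -- The averaging window runs from `n + 1` to `2n + 1`, so a bound on `W i` for large `i` passes to
  -- `w n` without an error term.
  let w : ℕ → C(Subshift A, ℝ) →ₗ[ℝ] ℝ := fun n =>
    ((n : ℝ) + 1)⁻¹ • ∑ i ∈ Finset.range (n + 1), W (n + 1 + i)
  have hw : ∀ n f, w n f = ((n : ℝ) + 1)⁻¹ * ∑ i ∈ Finset.range (n + 1), W (n + 1 + i) f :=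
    fun n f => by simp [w]
  have hwle : ∀ n f K', (∀ i, n < i → W i f ≤ K') → w n f ≤ K' := fun n f K' hf => by
    rw [hw, inv_mul_le_iff₀ (by positivity)]
    refine (Finset.sum_le_sum fun i _ => hf (n + 1 + i) (by omega)).trans (le_of_eq ?_)
    simp
  obtain ⟨ν, 𝒰, hν, h𝒰, hlim⟩ := exists_limit_measure w (fun n f hf => by
    rw [hw]
    exact mul_nonneg (by positivity) (Finset.sum_nonneg fun i _ => hWpos _ f hf)) (fun n => by
    rw [hw]
    simp only [hWone, Finset.sum_const, Finset.card_range, nsmul_eq_mul, mul_one]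
    push_cast
    exact inv_mul_cancel₀ (by positivity))
  have hclopen : ∀ S : Set (Subshift A), IsClopen S → ∀ K' : ℝ, ∀ m : ℕ,
      (∀ i, m < i → (r ^ i)⁻¹ * (op G ^ i) (S.indicator h) x0 ≤ K' * h x0) → ν.real S ≤ K' := by
    intro S hS K' m hi
    let f : C(Subshift A, ℝ) := ⟨S.indicator fun _ => 1,
      continuous_const.indicator (by simp [hS.frontier_eq])⟩
    have h1 : ∫ x, f x ∂ν = ν.real S := by
      change ∫ x, S.indicator (fun _ => (1 : ℝ)) x ∂ν = _
      rw [integral_indicator hS.isOpen.measurableSet, setIntegral_const, smul_eq_mul, mul_one]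
    rw [← h1]
    refine le_of_tendsto (hlim f) (h𝒰 ?_)
    filter_upwards [eventually_ge_atTop m] with n hn
    refine hwle n f K' fun i hni => ?_
    rw [hW, div_le_iff₀ hx0]
    have : (fun x => h x * f x) = S.indicator h := by
      funext x
      change h x * S.indicator (fun _ => (1 : ℝ)) x = _
      by_cases hx : x ∈ S <;> simp [hx]
    rw [this]
    exact hi i (by omega)
  refine ⟨ν, K, hν, ⟨continuous_shift.measurable, ?_⟩, ?_, hK, fun n y => ?_⟩
  · have : IsFiniteMeasure (ν.map shift) := Measure.isFiniteMeasure_map ν shift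
    refine ext_of_forall_integral_eq_of_IsFiniteMeasure fun f => ?_
    rw [integral_map continuous_shift.measurable.aemeasurable
      f.continuous.aestronglyMeasurable]
    have h1 := (hlim (f.toContinuousMap.comp σ)).sub (hlim f.toContinuousMap)
    refine sub_eq_zero.1 (tendsto_nhds_unique h1 ?_)
    have hzero : Tendsto (fun n : ℕ => 2 * ‖f.toContinuousMap‖ * (1 / ((n : ℝ) + 1))) atTop
        (𝓝 0) := by
      simpa using (tendsto_one_div_add_atTop_nhds_zero_nat (𝕜 := ℝ)).const_mul
        (2 * ‖f.toContinuousMap‖)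
    refine squeeze_zero_norm (fun n => ?_) (hzero.mono_left h𝒰)
    have hWbd : ∀ i (g : C(Subshift A, ℝ)), |W i g| ≤ ‖g‖ := fun i g => by
      have hc : ∀ c : ℝ, W i (c • 1) = c := fun c => by
        rw [map_smul, hWone, smul_eq_mul, mul_one]
      have h2 := hWpos i (‖g‖ • 1 - g) (fun x => by
        simpa using (abs_le.1 (g.norm_coe_le_norm x)).2)
      have h3 := hWpos i (g - (-‖g‖) • 1) (fun x => by
        have := (abs_le.1 (g.norm_coe_le_norm x)).1
        change 0 ≤ g x - -‖g‖ * 1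
        linarith)
      rw [map_sub, hc] at h2 h3
      exact abs_le.2 ⟨by linarith, by linarith⟩
    -- The sum telescopes, leaving two bounded boundary terms divided by `n + 1`.
    have h4 : w n (f.toContinuousMap.comp σ) - w n f.toContinuousMap = ((n : ℝ) + 1)⁻¹ *
        (W n f.toContinuousMap - W (n + (n + 1)) f.toContinuousMap) := by
      rw [hw, hw, ← mul_sub, ← Finset.sum_sub_distrib]
      congr 1
      have h5 := Finset.sum_range_sub' (fun i => W (n + i) f.toContinuousMap) (n + 1)
      rw [add_zero] at h5
      rw [← h5]
      refine Finset.sum_congr rfl fun i _ => ?_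
      rw [show n + 1 + i = n + i + 1 by ring, hWshift, add_assoc n i 1]
    rw [h4, norm_mul, Real.norm_eq_abs, Real.norm_eq_abs, abs_of_pos (by positivity), mul_comm,
      one_div]
    refine mul_le_mul_of_nonneg_right ?_ (by positivity)
    refine (abs_sub _ _).trans ?_
    linarith [hWbd n f.toContinuousMap, hWbd (n + (n + 1)) f.toContinuousMap]
  · rw [← measureReal_eq_zero_iff]
    refine le_antisymm (hclopen V hV.isClopen 0 0 fun i hi => ?_) measureReal_nonneg
    obtain ⟨j, rfl⟩ : ∃ j, i = j + 1 := ⟨i - 1, by omega⟩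
    have : op G (V.indicator h) = 0 := by
      funext x
      rw [op_apply]
      refine Finset.sum_eq_zero fun a _ => ?_
      split_ifs
      · by_cases hx : pre a x ∈ V
        · rw [show G (pre a x) = 0 from indicator_of_notMem (notMem_compl_iff.2 hx) _,
            zero_mul]
        · rw [indicator_of_notMem hx, mul_zero]
      · rfl
    rw [op_pow_succ, this, map_zero]
    simp
  · refine hclopen _ (dependsOn_cylinder y n).isClopen _ n fun i hi => ?_
    obtain ⟨j, rfl⟩ : ∃ j, i = j + n := ⟨i - n, by omega⟩
    have h1 := op_pow_le_op_pow hG (hKcyl n y) j x0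
    rw [map_smul, op_eigen_pow he] at h1
    rw [pow_add (op G), Module.End.mul_apply, pow_add, mul_inv]
    have h2 := mul_le_mul_of_nonneg_left h1 (mul_pos (hrn j) (hrn n)).le
    refine h2.trans (le_of_eq ?_)
    simp only [Pi.smul_apply, smul_eq_mul]
    field_simp

theorem ae_mem_survivor {ν : Measure (Subshift A)} (hinv : MeasurePreserving shift ν ν)
    (hV : ν V = 0) : ∀ᵐ x ∂ν, x ∈ survivor V := by
  simp only [survivor_iff]
  rw [ae_all_iff]
  intro i
  have := (hinv.iterate i).quasiMeasurePreserving.preimage_null hV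
  exact measure_eq_zero_iff_ae_notMem.1 this

/-- The lower bound for the entropy of a measure with a Gibbs upper estimate. -/
theorem le_ksEntropy {K : ℝ} (hK : 0 < K) (hr : 0 < r) {ν : Measure (Subshift A)}
    [IsProbabilityMeasure ν] (hinv : MeasurePreserving shift ν ν) (hφc : Continuous φ)
    (hν : ∀ n y, ν.real (cylinder y n) ≤
        K * Real.exp (∑ i ∈ Finset.range n, φ (shift^[i] y)) * (r ^ n)⁻¹) :
    ((Real.log r - ∫ x, φ x ∂ν : ℝ) : EReal) ≤ ksEntropy ν shift := by
  let ξ : Subshift A → Fin l := fun x => x.1 0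
  have hξ : Measurable ξ := (continuous_coord 0).measurable
  have hφi : Integrable φ ν := by
    obtain ⟨M, -, hM⟩ := exists_bound hφc
    exact Integrable.of_bound hφc.aestronglyMeasurable M (Eventually.of_forall hM)
  have hi1 : ∀ i, Integrable (fun x => φ (shift^[i] x)) ν := fun i =>
    (hinv.iterate i).integrable_comp_of_integrable hφi
  refine le_trans ?_ (le_iSup_of_le l (le_iSup_of_le ξ (le_iSup_of_le hξ le_rfl)))
  have key : ∀ n : ℕ, -Real.log K + n * (Real.log r - ∫ x, φ x ∂ν) ≤
      partitionEntropy ν (fun x => fun i : Fin n => ξ (shift^[i] x)) := by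
    intro n
    let b : Subshift A → ℝ := fun x => -Real.log K + n * Real.log r -
      ∑ i ∈ Finset.range n, φ (shift^[i] x)
    have hb : Integrable b ν := (integrable_const _).sub (integrable_finsetSum _ fun i _ => hi1 i)
    have hm : Measurable (fun x => fun i : Fin n => ξ (shift^[i] x)) :=
      measurable_pi_lambda _ fun i => hξ.comp (hinv.iterate i).measurable
    refine le_trans (le_of_eq ?_) (integral_le_partitionEntropy hm hb fun x => ?_)
    · simp only [b]
      rw [integral_sub (integrable_const _) (integrable_finsetSum _ fun i _ => hi1 i),
        integral_finsetSum _ fun i _ => hi1 i]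
      simp [integral_comp_shift_iterate hinv hφi]
      ring
    · have h1 : (fun x => fun i : Fin n => ξ (shift^[i] x)) ⁻¹'
          {(fun i : Fin n => ξ (shift^[i] x))} = cylinder x n := by
        ext y
        simp only [mem_preimage, mem_singleton_iff, funext_iff, ξ, shift_iterate_apply, zero_add]
        exact ⟨fun h i hi => h ⟨i, hi⟩, fun h i => h i i.2⟩
      rw [h1]
      refine (hν n x).trans (le_of_eq ?_)
      have : -b x = Real.log K + ∑ i ∈ Finset.range n, φ (shift^[i] x) + -(n * Real.log r) := by
        simp only [b]; ring
      rw [this, Real.exp_add, Real.exp_add, Real.exp_log hK, Real.exp_neg, mul_comm (n : ℝ),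
        Real.exp_mul, Real.exp_log hr, Real.rpow_natCast]
  set a := Real.log r - ∫ x, φ x ∂ν
  have hlim : Tendsto (fun n : ℕ => ((-Real.log K / n + a : ℝ) : EReal)) atTop
      (𝓝 (a : EReal)) := by
    refine (continuous_coe_real_ereal.tendsto a).comp ?_
    simpa using (tendsto_const_div_atTop_nhds_zero_nat (-Real.log K)).add_const a
  rw [← hlim.limsup_eq]
  refine limsup_le_limsup ?_
  filter_upwards [eventually_gt_atTop 0] with n hn
  have hn' : (0 : ℝ) < n := by exact_mod_cast hn
  rw [EReal.coe_le_coe_iff, le_div_iff₀ hn']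
  refine le_trans (le_of_eq ?_) (key n)
  field_simp

/-- The variational principle on a survivor set. -/
theorem pressure_survivor_eq [Nonempty (Subshift A)] (hθ : 0 < θ) (hθ' : θ < 1) (hC : 0 ≤ C)
    (hφ : IsAgreeHolder θ C φ) (hV : DependsOn q V) (hq : 1 ≤ q)
    (hr : 0 < radius (holeWeight φ V)) :
    pressure φ (survivor V) = ((Real.log (radius (holeWeight φ V)) : ℝ) : EReal) := by
  have hφc := hφ.continuous hθ hθ'
  have hGc := continuous_holeWeight hφc hV
  have hmeas : MeasurableSet (survivor V) := (isClosed_survivor hV.isOpen).measurableSet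
  refine le_antisymm ?_ ?_
  · refine iSup_le fun ν => iSup_le fun hν => iSup_le fun hinv => iSup_le fun hs => ?_
    have hs' : ∀ᵐ x ∂ν, x ∈ survivor V := (mem_ae_iff_prob_eq_one hmeas).2 hs
    refine EReal.le_of_forall_lt_iff_le.1 fun z hz => ?_
    rw [EReal.coe_lt_coe_iff] at hz
    have h1 : radius (holeWeight φ V) < Real.exp z := by
      rw [← Real.exp_log hr]; exact Real.exp_lt_exp.2 hz
    have h2 := ksEntropy_le hV hφc
      (mem_growthRates_of_radius_lt (holeWeight_nonneg φ V) hGc h1) hinv hs'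
    rw [Real.log_exp] at h2
    refine (add_le_add_left h2 _).trans (le_of_eq ?_)
    rw [← EReal.coe_add, sub_add_cancel]
  -- The solution of `(C + B) θ = B`, the least constant whose log-Hölder cone is preserved by this
  -- estimate.
  · set B := C * θ / (1 - θ) with hB
    have hθ1 : 0 < 1 - θ := by linarith
    obtain ⟨h, hh, ⟨x0, hx0⟩, he⟩ := exists_eigenfunction (B := B) (hφ.logHolder hV) hq hθ hθ'
      (by positivity) (le_of_eq (by rw [hB]; field_simp; ring)) hr
    obtain ⟨ν, K, hν, hinv, hνV, hK, hcyl⟩ := exists_gibbs_measure hθ hθ' hC hφ hV hh he hr hx0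
    have hs := (mem_ae_iff_prob_eq_one hmeas).1 (ae_mem_survivor hinv hνV)
    have h1 := le_ksEntropy hK hr hinv hφc hcyl
    refine le_trans ?_ (le_iSup_of_le ν (le_iSup_of_le hν (le_iSup_of_le hinv
      (le_iSup_of_le hs le_rfl))))
    refine le_trans (le_of_eq ?_) (add_le_add_left h1 _)
    rw [← EReal.coe_add, sub_add_cancel]

end LowerBound

/-! ### Lower bound for the growth rate with a small hole -/

section SmallHoles

variable {l : ℕ} {A : Matrix (Fin l) (Fin l) ℕ} {φ h : Subshift A → ℝ} {lam : ℝ}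

theorem holeWeight_empty (φ : Subshift A → ℝ) : holeWeight φ ∅ = fun x => Real.exp (φ x) := by
  funext x; simp [holeWeight]

theorem holeWeight_empty_pos (φ : Subshift A → ℝ) (x : Subshift A) : 0 < holeWeight φ ∅ x := by
  rw [holeWeight_empty]; exact Real.exp_pos _

theorem exists_pos_le {f : Subshift A → ℝ} (hf : Continuous f) (h : ∀ x, 0 < f x) :
    ∃ c, 0 < c ∧ ∀ x, c ≤ f x := by
  rcases isEmpty_or_nonempty (Subshift A) with he | hne
  · exact ⟨1, one_pos, fun x => he.elim x⟩
  · obtain ⟨x, -, hx⟩ := isCompact_univ.exists_isMinOn univ_nonempty hf.continuousOn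
    exact ⟨f x, h x, fun y => hx (mem_univ y)⟩

/-- Every point has a preimage, so one application of the operator to 1 is at least the minimum of
the weight. -/
theorem radius_empty_pos [Nonempty (Subshift A)] (hφ : Continuous φ)
    (hsurj : ∀ x : Subshift A, ∃ y, shift y = x) : 0 < radius (holeWeight φ ∅) := by
  have hG := holeWeight_nonneg φ (∅ : Set (Subshift A))
  have hc := continuous_holeWeight hφ (dependsOn_empty (A := A) 0)
  obtain ⟨c, hc0, hcG⟩ := exists_pos_le hc (holeWeight_empty_pos φ)
  have h1 : c • (1 : Subshift A → ℝ) ≤ op (holeWeight φ ∅) 1 := fun x => by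
    obtain ⟨y, rfl⟩ := hsurj x
    have := le_op_shift hG (f := 1) (fun _ => zero_le_one) y
    simp only [Pi.one_apply, mul_one, Pi.smul_apply, smul_eq_mul] at this ⊢
    exact (hcG y).trans this
  have h2 : ∀ n : ℕ, c ^ n • (1 : Subshift A → ℝ) ≤ (op (holeWeight φ ∅) ^ n) 1 := fun n => by
    induction n with
    | zero => simp
    | succ n ih =>
      rw [op_pow_succ]
      refine le_trans ?_ (op_pow_le_op_pow hG h1 n)
      rw [map_smul, pow_succ', mul_smul]
      exact smul_le_smul_of_nonneg_left ih hc0.le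
  obtain ⟨x⟩ := (inferInstance : Nonempty (Subshift A))
  have h3 := le_radius_pow hG hc (N := 1) one_pos x (t := c) fun j => by
    have := h2 (1 * j) x
    simpa using this
  rw [pow_one] at h3
  exact hc0.trans_le h3

/-- The mixing eigenfunction is strictly positive. -/
theorem eigenfunction_pos (hA : ∀ i j, A i j = 0 ∨ A i j = 1) {d : ℕ}
    (hd : ∀ i j, 0 < (A ^ d) i j) {θ B : ℝ} {q : ℕ} (hh : LogHolder θ B q h) {x0 : Subshift A}
    (hx0 : 0 < h x0) (hlam : 0 < lam) (he : op (holeWeight φ ∅) h = lam • h) (x : Subshift A) :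
    0 < h x := by
  obtain ⟨w, hw, hwx⟩ := exists_preimage_mem_cylinder hA hd q x0 x
  have h1 : 0 < h w := by
    by_contra hle
    have h0 : h w = 0 := le_antisymm (not_lt.1 hle) (hh.nonneg w)
    have := hh.le_mul q le_rfl x0 w hw.symm
    rw [h0, mul_zero] at this
    linarith
  have h2 := le_op_pow_shift (holeWeight_nonneg φ ∅) hh.nonneg (q + d) w
  rw [hwx, op_eigen_pow he] at h2
  have h3 : 0 < (∏ i ∈ Finset.range (q + d), holeWeight φ ∅ (shift^[i] w)) * h w :=
    mul_pos (Finset.prod_pos fun i _ => holeWeight_empty_pos φ _) h1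
  have h4 : 0 < lam ^ (q + d) * h x := h3.trans_le h2
  exact pos_of_mul_pos_right h4 (by positivity)

/-- A single cylinder carries a definite fraction less than the full transfer operator. -/
theorem exists_op_pow_cylinder_contraction [Nonempty (Subshift A)]
    (hA : ∀ i j, A i j = 0 ∨ A i j = 1) (hl : 2 ≤ l) {d : ℕ} (h0 : 0 < d)
    (hd : ∀ i j, 0 < (A ^ d) i j) (hφ : Continuous φ) (hc : Continuous h) (hpos : ∀ x, 0 < h x)
    (he : op (holeWeight φ ∅) h = lam • h) :
    ∃ κ, 0 ≤ κ ∧ κ < lam ^ d ∧ ∀ y,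
      (op (holeWeight φ ∅) ^ d) ((cylinder y d).indicator h) ≤ κ • h := by
  set G := holeWeight φ (∅ : Set (Subshift A))
  have hG : 0 ≤ G := holeWeight_nonneg φ ∅
  have hGc : Continuous G := continuous_holeWeight hφ (dependsOn_empty 0)
  have hh : 0 ≤ h := fun x => (hpos x).le
  have hdep : ∀ a : Fin l, DependsOn 1 {x : Subshift A | x.1 0 = a} := fun a x y hxy hx =>
    (hxy 0 Nat.one_pos).symm.trans hx
  -- By primitivity every point has a `d`-fold preimage starting with `a`, so this continuous
  -- function is positive, and compactness bounds it below.
  have hmin : ∀ a : Fin l, ∃ c, 0 < c ∧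
      ∀ x, c ≤ (op G ^ d) ({x : Subshift A | x.1 0 = a}.indicator h) x := fun a => by
    refine exists_pos_le (continuous_op_pow hGc (hc.indicator
      (by simp [(hdep a).isClopen.frontier_eq])) d) fun x => ?_
    obtain ⟨y, hy, hyx⟩ := exists_path hA d a x (hd _ _)
    have := le_op_pow_shift hG (f := {x : Subshift A | x.1 0 = a}.indicator h)
      (fun x => indicator_nonneg (fun _ _ => hh _) x) d y
    rw [hyx, indicator_of_mem (show y ∈ {x : Subshift A | x.1 0 = a} from hy)] at this
    exact (mul_pos (Finset.prod_pos fun i _ => holeWeight_empty_pos φ _) (hpos y)).trans_le this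
  choose c hc0 hcx using hmin
  obtain ⟨x0⟩ := (inferInstance : Nonempty (Subshift A))
  have : Nonempty (Fin l) := ⟨x0.1 0⟩
  obtain ⟨a0, ha0⟩ := Finite.exists_min c
  obtain ⟨M, hM, hhM⟩ := exists_bound hc
  have hle : ∀ y, (op G ^ d) ((cylinder y d).indicator h) ≤ (lam ^ d - c a0 / M) • h := by
    intro y x
    -- The points starting with another symbol are disjoint from `[y]_d`. Their share of `λ^d h`, at
    -- least `c a0`, is lost to the cylinder, and `c a0 ≥ (c a0 / M) h`.
    obtain ⟨a, ha⟩ : ∃ a : Fin l, a ≠ y.1 0 := by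
      have : Nontrivial (Fin l) := Fin.nontrivial_iff_two_le.2 hl
      exact exists_ne _
    have h1 : (cylinder y d).indicator h + {x : Subshift A | x.1 0 = a}.indicator h ≤ h := by
      intro x
      rw [Pi.add_apply]
      by_cases hx : x.1 0 = a
      · rw [indicator_of_notMem (show x ∉ cylinder y d from fun hxy =>
          ha (hx.symm.trans (hxy 0 h0))), zero_add]
        exact indicator_le_self' (fun _ _ => hh _) x
      · rw [indicator_of_notMem (show x ∉ {x : Subshift A | x.1 0 = a} from hx), add_zero]
        exact indicator_le_self' (fun _ _ => hh _) x
    have h2 := op_pow_le_op_pow hG h1 d x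
    rw [map_add, op_eigen_pow he] at h2
    simp only [Pi.add_apply, Pi.smul_apply, smul_eq_mul] at h2 ⊢
    have h3 := (ha0 a).trans (hcx a x)
    have h4 : c a0 / M * h x ≤ c a0 := by
      rw [div_mul_eq_mul_div, div_le_iff₀ hM]
      exact mul_le_mul_of_nonneg_left ((le_abs_self _).trans (hhM x)) (hc0 a0).le
    rw [sub_mul]
    linarith
  refine ⟨_, ?_, sub_lt_self _ (div_pos (hc0 a0) hM), hle⟩
  have h5 := (op_pow_nonneg hG (f := (cylinder x0 d).indicator h)
    (fun x => indicator_nonneg (fun _ _ => hh _) x) d x0).trans (hle x0 x0)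
  exact nonneg_of_mul_nonneg_left h5 (hpos x0)

theorem indicator_eq_mul_of_mem_iff {X : Type*} {S S₁ S₂ : Set X} {g : X → X}
    (hS : ∀ y, y ∈ S ↔ y ∈ S₁ ∧ g y ∈ S₂) (f : X → ℝ) :
    S.indicator f = fun y => S₁.indicator f y * S₂.indicator 1 (g y) := by
  classical
  funext y
  simp only [indicator_apply, hS, Pi.one_apply]
  by_cases h1 : y ∈ S₁ <;> by_cases h2 : g y ∈ S₂ <;> simp [h1, h2]

/-- A cylinder of length `d j` is `j` successive constraints of length `d`, each of which
contributes one factor `κ`. -/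
theorem op_pow_cylinder_le {G : Subshift A → ℝ} (hG : 0 ≤ G) (hh : 0 ≤ h) {d : ℕ} {κ : ℝ}
    (hκ : 0 ≤ κ) (hle : ∀ y, (op G ^ d) ((cylinder y d).indicator h) ≤ κ • h) (j : ℕ)
    (y : Subshift A) :
    (op G ^ (d * j)) ((cylinder y (d * j)).indicator h) ≤ κ ^ j • h := by
  induction j generalizing y with
  | zero =>
    intro x
    simpa using indicator_le_self' (s := cylinder y 0) (fun x _ => hh x) x
  | succ j ih =>
    have h1 : (cylinder y (d * (j + 1))).indicator h = fun x => (cylinder y d).indicator h x *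
        (cylinder (shift^[d] y) (d * j)).indicator 1 (shift^[d] x) := by
      have hdj : d * (j + 1) = d * j + d := mul_add_one d j
      refine indicator_eq_mul_of_mem_iff (fun x => Iff.intro (fun hx => ?_) ?_) h
      · exact ⟨Agree.mono hx (Nat.le_mul_of_pos_right d j.succ_pos),
          Agree.shift_iterate (Agree.mono hx hdj.ge)⟩
      rintro ⟨hx1, hx2⟩ i hi
      by_cases hid : i < d
      · exact hx1 i hid
      · have := hx2 (i - d) (by have := lt_of_lt_of_eq hi hdj; omega)
        rwa [shift_iterate_apply, shift_iterate_apply, Nat.sub_add_cancel (not_lt.1 hid)] at this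
    rw [h1, mul_add, mul_one, pow_add, Module.End.mul_apply, op_pow_mul_comp_shift]
    have h2 : (fun x => (op G ^ d) ((cylinder y d).indicator h) x *
        (cylinder (shift^[d] y) (d * j)).indicator 1 x) ≤
        κ • (cylinder (shift^[d] y) (d * j)).indicator h := by
      intro x
      by_cases hx : x ∈ cylinder (shift^[d] y) (d * j)
      · simpa [hx] using hle y x
      · simp [hx]
    refine (op_pow_le_op_pow hG h2 (d * j)).trans ?_
    rw [map_smul, pow_succ', mul_smul]
    exact smul_le_smul_of_nonneg_left (ih _) hκ

/-- The cut-offs made at each step accumulate into the single condition that the first `n` points of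
the orbit miss `V`. -/
theorem op_holeWeight_pow (φ : Subshift A → ℝ) (V : Set (Subshift A)) (n : ℕ)
    (f : Subshift A → ℝ) : (op (holeWeight φ V) ^ n) f =
      (op (holeWeight φ ∅) ^ n) ({y | ∀ i < n, shift^[i] y ∉ V}.indicator f) := by
  classical
  induction n generalizing f with
  | zero =>
    have : {y : Subshift A | ∀ i < 0, shift^[i] y ∉ V} = univ := by ext; simp
    rw [this, indicator_univ]
    rfl
  | succ n ih =>
    rw [op_pow_succ, op_pow_succ, ih]
    congr 1
    have h1 : {y | ∀ i < n + 1, shift^[i] y ∉ V}.indicator f = fun y => Vᶜ.indicator f y *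
        {y | ∀ i < n, shift^[i] y ∉ V}.indicator 1 (shift y) := by
      refine indicator_eq_mul_of_mem_iff (fun y => Iff.intro (fun hy => ?_) ?_) f
      · exact ⟨hy 0 n.succ_pos, fun i hi => hy (i + 1) (by omega)⟩
      rintro ⟨hy1, hy2⟩ i hi
      cases i with
      | zero => exact hy1
      | succ i => exact hy2 i (by omega)
    rw [h1, op_mul_comp_shift]
    have h2 : op (holeWeight φ V) f = op (holeWeight φ ∅) (Vᶜ.indicator f) := by
      funext x
      rw [op_apply, op_apply]
      refine Finset.sum_congr rfl fun a _ => ?_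
      congr 1
      by_cases hx : pre a x ∈ V <;> simp [holeWeight, hx]
    funext x
    rw [h2]
    by_cases hx : x ∈ {y | ∀ i < n, shift^[i] y ∉ V}
    · rw [indicator_of_mem hx, indicator_of_mem hx]; simp
    · rw [indicator_of_notMem hx, indicator_of_notMem hx, mul_zero]

/-- Points whose first `N`-block does not occur in `z` at a position below `N`. -/
def avoiding (z : Subshift A) (N : ℕ) : Set (Subshift A) :=
  {x | ∀ i < N, x ∉ cylinder (shift^[i] z) N}

/-- Round `i` up to a multiple `N j`. A visit to `[z]_{2N}` at time `i` would show at time `N j` the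
block of length `N` in `z` that begins at position `N j - i < N`, which is forbidden there. -/
theorem avoid_hole {z : Subshift A} {V : Set (Subshift A)} {N : ℕ} (hN : 0 < N)
    (hV : V ⊆ cylinder z (2 * N)) {t : ℕ} {y : Subshift A}
    (hy : ∀ j ≤ t, shift^[N * j] y ∈ avoiding z N) : ∀ i < N * t, shift^[i] y ∉ V := by
  intro i hi hiV
  have h1 := Nat.div_add_mod (i + (N - 1)) N
  have h2 := Nat.mod_lt (i + (N - 1)) hN
  set j := (i + (N - 1)) / N
  have hj : j ≤ t := by
    by_contra hlt
    have : N * (t + 1) ≤ N * j := Nat.mul_le_mul_left N (by omega)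
    rw [mul_add, mul_one] at this
    omega
  refine hy j hj (N * j - i) (by omega) ?_
  have h3 : Agree (N + (N * j - i)) (shift^[i] y) z := Agree.mono (hV hiV) (by omega)
  have h4 := h3.shift_iterate
  rwa [← Function.iterate_add_apply, Nat.sub_add_cancel (by omega)] at h4

/-- The `N` forbidden cylinders remove at most `N κ h ≤ (λ^N / 2) h` from the `N`-th iterate of `h`.
Iterating over blocks of length `N` leaves at least `(λ^N / 2)^t h` carried by orbits that avoid the
hole. -/
theorem half_pow_le_radius_pow [Nonempty (Subshift A)] (hφ : Continuous φ) (hc : Continuous h)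
    (hpos : ∀ x, 0 < h x) (hlam : 0 < lam) (he : op (holeWeight φ ∅) h = lam • h) {N : ℕ}
    (hN : 0 < N) {z : Subshift A} {κ : ℝ} (hκ : N * κ ≤ lam ^ N / 2)
    (hcyl : ∀ y, (op (holeWeight φ ∅) ^ N) ((cylinder y N).indicator h) ≤ κ • h)
    {V : Set (Subshift A)} {q : ℕ} (hVq : DependsOn q V) (hV : V ⊆ cylinder z (2 * N)) :
    lam ^ N / 2 ≤ radius (holeWeight φ V) ^ N := by
  classical
  set G := holeWeight φ (∅ : Set (Subshift A)) with hGdef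
  have hG : 0 ≤ G := holeWeight_nonneg φ ∅
  have hh : 0 ≤ h := fun x => (hpos x).le
  set S := avoiding z N
  have hS : (lam ^ N / 2) • h ≤ (op G ^ N) (S.indicator h) := by
    have h1 : h - ∑ i ∈ Finset.range N, (cylinder (shift^[i] z) N).indicator h ≤
        S.indicator h := by
      intro x
      rw [Pi.sub_apply, Finset.sum_apply]
      have hnn : ∀ i ∈ Finset.range N, 0 ≤ (cylinder (shift^[i] z) N).indicator h x :=
        fun i _ => indicator_nonneg (fun _ _ => hh _) x
      by_cases hx : x ∈ S
      · rw [indicator_of_mem hx]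
        linarith [Finset.sum_nonneg hnn]
      · rw [indicator_of_notMem hx]
        simp only [S, avoiding, mem_ofPred_eq, not_forall, not_not] at hx
        obtain ⟨i, hi, hxi⟩ := hx
        have := Finset.single_le_sum hnn (Finset.mem_range.2 hi)
        rw [indicator_of_mem hxi] at this
        linarith
    have h2 := op_pow_le_op_pow hG h1 N
    rw [map_sub, map_sum, op_eigen_pow he] at h2
    refine le_trans (fun x => ?_) h2
    rw [Pi.sub_apply, Finset.sum_apply]
    have h3 : ∑ i ∈ Finset.range N, (op G ^ N) ((cylinder (shift^[i] z) N).indicator h) x ≤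
        N * (κ * h x) := by
      refine (Finset.sum_le_sum fun i _ => hcyl _ x).trans (le_of_eq ?_)
      simp
    simp only [Pi.smul_apply, smul_eq_mul]
    have h4 := mul_le_mul_of_nonneg_right hκ (hpos x).le
    linarith
  have hiter : ∀ t : ℕ, (lam ^ N / 2) ^ t • h ≤
      (op G ^ (N * t)) ({y | ∀ j < t, shift^[N * j] y ∈ S}.indicator h) := by
    intro t
    induction t with
    | zero =>
      have : {y : Subshift A | ∀ j < 0, shift^[N * j] y ∈ S} = univ := by ext; simp
      rw [this]
      simp
    | succ t ih =>
      have h1 : {y | ∀ j < t + 1, shift^[N * j] y ∈ S}.indicator h = fun y => S.indicator h y *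
          {y | ∀ j < t, shift^[N * j] y ∈ S}.indicator 1 (shift^[N] y) := by
        refine indicator_eq_mul_of_mem_iff (fun y => Iff.intro (fun hy => ?_) ?_) h
        · refine ⟨hy 0 t.succ_pos, fun j hj => ?_⟩
          rw [← Function.iterate_add_apply, ← mul_add_one]
          exact hy (j + 1) (by omega)
        · rintro ⟨hy1, hy2⟩ j hj
          cases j with
          | zero => exact hy1
          | succ j =>
            rw [mul_add_one, Function.iterate_add_apply]
            exact hy2 j (by omega)
      rw [h1, mul_add_one, pow_add (op G), Module.End.mul_apply, op_pow_mul_comp_shift]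
      have h2 : (lam ^ N / 2) • {y | ∀ j < t, shift^[N * j] y ∈ S}.indicator h ≤
          fun x => (op G ^ N) (S.indicator h) x *
            {y | ∀ j < t, shift^[N * j] y ∈ S}.indicator 1 x := by
        intro x
        by_cases hx : x ∈ {y | ∀ j < t, shift^[N * j] y ∈ S}
        · simp only [Pi.smul_apply]
          rw [indicator_of_mem hx, indicator_of_mem hx]
          simpa using hS x
        · simp only [Pi.smul_apply]
          rw [indicator_of_notMem hx, indicator_of_notMem hx]
          simp
      refine le_trans ?_ (op_pow_le_op_pow hG h2 (N * t))
      rw [map_smul, pow_succ', mul_smul]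
      exact smul_le_smul_of_nonneg_left ih (by positivity)
  obtain ⟨x, hx⟩ : S.Nonempty := by
    by_contra hne
    rw [not_nonempty_iff_eq_empty] at hne
    rw [hne, indicator_empty] at hS
    obtain ⟨x⟩ := (inferInstance : Nonempty (Subshift A))
    have h1 := hS x
    have h0 : (fun _ : Subshift A => (0 : ℝ)) = 0 := rfl
    rw [h0, map_zero] at h1
    have h2 : 0 < lam ^ N / 2 * h x := mul_pos (by positivity) (hpos x)
    exact absurd h1 (not_le.2 h2)
  obtain ⟨M, hM, hhM⟩ := exists_bound hc
  refine le_radius_pow (holeWeight_nonneg φ V) (continuous_holeWeight hφ hVq)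
    (c := h x / M) (div_pos (hpos x) hM) x fun t => ?_
  rw [op_holeWeight_pow, ← hGdef]
  set Bt := {y : Subshift A | ∀ j < t, shift^[N * j] y ∈ S}
  -- Avoiding the hole up to time `N t` also requires the block condition at the final time `N t`.
  -- It holds automatically because the iterate is evaluated at a point `x` of `S`.
  have h1 : (fun y => (M⁻¹ • Bt.indicator h) y * S.indicator 1 (shift^[N * t] y)) ≤
      {y | ∀ i < N * t, shift^[i] y ∉ V}.indicator 1 := by
    intro y
    by_cases hy1 : y ∈ Bt
    · by_cases hy2 : shift^[N * t] y ∈ S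
      · have hy3 : y ∈ {y | ∀ i < N * t, shift^[i] y ∉ V} := avoid_hole hN hV fun j hj => by
          rcases hj.lt_or_eq with hj | rfl
          · exact hy1 j hj
          · exact hy2
        rw [indicator_of_mem hy3]
        simp only [Pi.smul_apply]
        rw [indicator_of_mem hy1, indicator_of_mem hy2]
        simp only [smul_eq_mul, Pi.one_apply, mul_one]
        rw [inv_mul_le_iff₀ hM, mul_one]
        exact (le_abs_self _).trans (hhM y)
      · simp only [indicator_of_notMem hy2, mul_zero]
        exact indicator_nonneg (fun _ _ => zero_le_one) y
    · simp only [Pi.smul_apply]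
      rw [indicator_of_notMem hy1, smul_zero, zero_mul]
      exact indicator_nonneg (fun _ _ => zero_le_one) y
  have h2 := op_pow_le_op_pow hG h1 (N * t) x
  rw [op_pow_mul_comp_shift, map_smul] at h2
  dsimp only at h2
  rw [indicator_of_mem hx, Pi.one_apply, mul_one] at h2
  refine le_trans ?_ h2
  simp only [Pi.smul_apply, smul_eq_mul]
  have h3 := mul_le_mul_of_nonneg_left (hiter t x) (inv_nonneg.2 hM.le)
  refine le_trans (le_of_eq ?_) h3
  simp only [Pi.smul_apply, smul_eq_mul]
  field_simp

/-- Small holes have growth rate close to the full one. -/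
theorem eventually_lt_radius (hA : ∀ i j, A i j = 0 ∨ A i j = 1) (hl : 2 ≤ l) {d : ℕ}
    (h0 : 0 < d) (hd : ∀ i j, 0 < (A ^ d) i j) (hφ : Continuous φ) (hc : Continuous h)
    (hpos : ∀ x, 0 < h x) (hlam : 0 < lam) (he : op (holeWeight φ ∅) h = lam • h)
    (z : Subshift A) {s : ℝ} (hs0 : 0 ≤ s) (hs : s < lam) :
    ∃ Q, ∀ V q, DependsOn q V → V ⊆ cylinder z Q → s ≤ radius (holeWeight φ V) := by
  have : Nonempty (Subshift A) := ⟨z⟩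
  obtain ⟨κ, hκ0, hκ, hle⟩ := exists_op_pow_cylinder_contraction hA hl h0 hd hφ hc hpos he
  have hlamd : 0 < lam ^ d := by positivity
  have hlim1 : Tendsto (fun j : ℕ => (d : ℝ) * ((j : ℝ) * (κ / lam ^ d) ^ j)) atTop (𝓝 0) := by
    simpa using (tendsto_self_mul_const_pow_of_lt_one (by positivity)
      ((div_lt_one hlamd).2 hκ)).const_mul (d : ℝ)
  have hlim2 : Tendsto (fun j : ℕ => ((s / lam) ^ d) ^ j) atTop (𝓝 0) :=
    tendsto_pow_atTop_nhds_zero_of_lt_one (by positivity)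
      (pow_lt_one₀ (by positivity) ((div_lt_one hlam).2 hs) h0.ne')
  -- With `N = d j`, the first condition makes the `N` cylinders cost at most half of `λ^N`; the
  -- second makes `s^N ≤ λ^N / 2`, which absorbs the lost factor.
  obtain ⟨j, ⟨hj1, hj2⟩, hj0⟩ := (((hlim1.eventually (gt_mem_nhds (show (0 : ℝ) < 1 / 2 by
    norm_num))).and (hlim2.eventually (gt_mem_nhds (show (0 : ℝ) < 1 / 2 by norm_num)))).and
    (eventually_gt_atTop 0)).exists
  have hN : 0 < d * j := Nat.mul_pos h0 hj0
  refine ⟨2 * (d * j), fun V q hVq hV => ?_⟩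
  have h1 := half_pow_le_radius_pow hφ hc hpos hlam he hN (z := z) (κ := κ ^ j) (by
    rw [div_pow, ← mul_assoc, ← mul_div_assoc, div_lt_iff₀ (by positivity), ← pow_mul] at hj1
    push_cast
    linarith) (op_pow_cylinder_le (holeWeight_nonneg φ ∅) (fun x => (hpos x).le) hκ0 hle j) hVq hV
  have h2 : s ^ (d * j) ≤ lam ^ (d * j) / 2 := by
    rw [← pow_mul, div_pow, div_lt_iff₀ (by positivity)] at hj2
    linarith
  exact le_of_pow_le_pow_left₀ hN.ne' radius_nonneg (h2.trans h1)

end SmallHoles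

/-! ### Invariance of an equilibrium state under the normalised operator -/

section Equilibrium

variable {l : ℕ} {A : Matrix (Fin l) (Fin l) ℕ} {φ h : Subshift A → ℝ} {lam : ℝ}
  {μ : Measure (Subshift A)}

theorem integrable_of_continuous [IsFiniteMeasure μ] {f : Subshift A → ℝ} (hf : Continuous f) :
    Integrable f μ := by
  obtain ⟨M, -, hM⟩ := exists_bound hf
  exact Integrable.of_bound hf.aestronglyMeasurable M (Eventually.of_forall hM)

theorem sub_two_mul_sq_le_log {u : ℝ} (hu : |u| ≤ 1 / 2) : u - 2 * u ^ 2 ≤ Real.log (1 + u) := by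
  have hu' := abs_le.1 hu
  have hpos : 0 < 1 + u := by linarith [hu'.1]
  refine le_trans ?_ (Real.one_sub_inv_le_log_of_pos hpos)
  rw [← sub_nonneg]
  have : 1 - (1 + u)⁻¹ - (u - 2 * u ^ 2) = u ^ 2 * (1 + 2 * u) / (1 + u) := by
    field_simp
    ring
  rw [this]
  exact div_nonneg (mul_nonneg (sq_nonneg u) (by linarith [hu'.1])) hpos.le

theorem mem_growthRates_of_eigenfunction {G : Subshift A → ℝ} (hG : 0 ≤ G) (hc : Continuous h)
    (hpos : ∀ x, 0 < h x) (hlam : 0 < lam) (he : op G h = lam • h) : lam ∈ growthRates G := by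
  obtain ⟨M, hM, hhM⟩ := exists_bound hc
  obtain ⟨c, hc0, hch⟩ := exists_pos_le hc hpos
  refine ⟨hlam, M / c, by positivity, fun n x => ?_⟩
  have h1 : (1 : Subshift A → ℝ) ≤ c⁻¹ • h := fun x => by
    simp only [Pi.one_apply, Pi.smul_apply, smul_eq_mul]
    rw [le_inv_mul_iff₀ hc0, mul_one]
    exact hch x
  refine (op_pow_le_op_pow hG h1 n x).trans ?_
  rw [map_smul, op_eigen_pow he]
  simp only [Pi.smul_apply, smul_eq_mul]
  have h2 : lam ^ n * h x ≤ lam ^ n * M :=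
    mul_le_mul_of_nonneg_left ((le_abs_self _).trans (hhM x)) (by positivity)
  refine (mul_le_mul_of_nonneg_left h2 (inv_nonneg.2 hc0.le)).trans (le_of_eq ?_)
  field_simp

/-- Perturbing the potential without changing the eigenfunction. -/
theorem integral_log_one_add_nonpos (hφ : Continuous φ) [IsProbabilityMeasure μ]
    (hinv : MeasurePreserving shift μ μ)
    (heq : ksEntropy μ shift + ((∫ x, φ x ∂μ : ℝ) : EReal) = ((Real.log lam : ℝ) : EReal))
    (hc : Continuous h) (hpos : ∀ x, 0 < h x) (hlam : 0 < lam)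
    {u : Subshift A → ℝ} (hu : Continuous u) (hu' : ∀ x, 0 < 1 + u x)
    (he : op (fun x => Real.exp (φ x) * (1 + u x)) h = lam • h) :
    ∫ x, Real.log (1 + u x) ∂μ ≤ 0 := by
  have hlog : Continuous fun x => Real.log (1 + u x) :=
    (continuous_const.add hu).log fun x => (hu' x).ne'
  -- The new potential still has growth at most `λ`, so its pressure bound applied to `μ`, compared
  -- with equality for `φ`, leaves only the integral of the perturbation.
  set φ' : Subshift A → ℝ := fun x => φ x + Real.log (1 + u x)
  have hφ' : Continuous φ' := hφ.add hlog
  have hG : holeWeight φ' ∅ = fun x => Real.exp (φ x) * (1 + u x) := by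
    rw [holeWeight_empty]
    funext x
    rw [Real.exp_add, Real.exp_log (hu' x)]
  have h1 := ksEntropy_le (dependsOn_empty 0) hφ' (mem_growthRates_of_eigenfunction
    (holeWeight_nonneg φ' ∅) hc hpos hlam (hG ▸ he)) hinv
    (Eventually.of_forall fun x => by simp [survivor])
  have h2 := add_le_add_left h1 ((∫ x, φ x ∂μ : ℝ) : EReal)
  rw [heq, ← EReal.coe_add, EReal.coe_le_coe_iff, integral_add (integrable_of_continuous hφ)
    (integrable_of_continuous hlog)] at h2
  linarith

/-- An equilibrium state is invariant under the normalised transfer operator. -/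
theorem integral_eq_integral_op (hφ : Continuous φ) [IsProbabilityMeasure μ]
    (hinv : MeasurePreserving shift μ μ)
    (heq : ksEntropy μ shift + ((∫ x, φ x ∂μ : ℝ) : EReal) = ((Real.log lam : ℝ) : EReal))
    (hc : Continuous h) (hpos : ∀ x, 0 < h x) (hlam : 0 < lam)
    (he : op (holeWeight φ ∅) h = lam • h) {f : Subshift A → ℝ} (hf : Continuous f) :
    ∫ x, f x ∂μ = ∫ x, op (holeWeight φ ∅) (fun y => h y * f y) x / (lam * h x) ∂μ := by
  set G := holeWeight φ (∅ : Set (Subshift A)) with hGdef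
  have hGc : Continuous G := continuous_holeWeight hφ (dependsOn_empty 0)
  set F : Subshift A → ℝ := fun x => op G (fun y => h y * f y) x / (lam * h x) with hF
  have hFc : Continuous F := (continuous_op hGc (hc.mul hf)).div (continuous_const.mul hc)
    fun x => (mul_pos hlam (hpos x)).ne'
  -- Chosen so that the operator kills `h ψ`: the weight `exp φ · (1 + t ψ)` then has the same
  -- eigenfunction and eigenvalue for every `t`.
  set ψ : Subshift A → ℝ := fun x => f x - F (shift x) with hψ
  have hψc : Continuous ψ := hf.sub (hFc.comp continuous_shift)
  obtain ⟨M, hM, hψM⟩ := exists_bound hψc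
  have hopψ : op G (fun x => h x * ψ x) = 0 := by
    have h1 : (fun x => h x * ψ x) =
        (fun x => h x * f x) - fun x => h x * F (shift x) := by
      funext x
      simp only [hψ, Pi.sub_apply]
      ring
    rw [h1, map_sub, op_mul_comp_shift, he]
    funext x
    simp only [Pi.sub_apply, Pi.smul_apply, smul_eq_mul, Pi.zero_apply, hF]
    rw [mul_div_cancel₀ _ (mul_pos hlam (hpos x)).ne', sub_self]
  -- First order against second order, for both signs of `t`; letting `t` be small forces the
  -- integral of `ψ` to vanish.
  have key : ∀ t : ℝ, |t| * M ≤ 1 / 2 → t * ∫ x, ψ x ∂μ ≤ 2 * (t * M) ^ 2 := by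
    intro t ht
    have hub : ∀ x, |t * ψ x| ≤ |t| * M := fun x => by
      rw [abs_mul]; exact mul_le_mul_of_nonneg_left (hψM x) (abs_nonneg t)
    have hpos' : ∀ x, 0 < 1 + t * ψ x := fun x => by
      linarith [(abs_le.1 ((hub x).trans ht)).1]
    have hcont : Continuous fun x => t * ψ x := continuous_const.mul hψc
    have h1 := integral_log_one_add_nonpos hφ hinv heq hc hpos hlam hcont hpos' (by
      have h2 : op (fun x => Real.exp (φ x) * (1 + t * ψ x)) h =
          op G h + t • op G (fun x => h x * ψ x) := by
        funext x
        simp only [op_apply, Pi.add_apply, Pi.smul_apply, smul_eq_mul, Finset.mul_sum,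
          ← Finset.sum_add_distrib]
        refine Finset.sum_congr rfl fun a _ => ?_
        rw [hGdef, holeWeight_empty]
        split_ifs <;> ring
      rw [h2, hopψ, smul_zero, add_zero, he])
    have h3 : ∫ x, (t * ψ x - 2 * (t * M) ^ 2) ∂μ ≤ ∫ x, Real.log (1 + t * ψ x) ∂μ := by
      refine integral_mono ((integrable_of_continuous hcont).sub (integrable_const _))
        (integrable_of_continuous ((continuous_const.add hcont).log fun x => (hpos' x).ne'))
        fun x => ?_
      refine le_trans ?_ (sub_two_mul_sq_le_log ((hub x).trans ht))
      have h4 : (t * ψ x) ^ 2 ≤ (t * M) ^ 2 := by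
        rw [mul_pow, mul_pow]
        exact mul_le_mul_of_nonneg_left (sq_le_sq' (abs_le.1 (hψM x)).1 (abs_le.1 (hψM x)).2)
          (sq_nonneg t)
      linarith
    rw [integral_sub (integrable_of_continuous hcont) (integrable_const _),
      integral_const_mul] at h3
    simp only [integral_const, probReal_univ, smul_eq_mul, one_mul] at h3
    linarith
  have hzero : ∫ x, ψ x ∂μ = 0 := by
    set I := ∫ x, ψ x ∂μ
    by_contra hI
    have hIpos : 0 < |I| := abs_pos.2 hI
    -- The first entry makes `t` admissible in `key`; the second makes the quadratic term at most `t
    -- |I| / 2`.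
    set t := min (1 / (2 * M)) (|I| / (4 * M ^ 2)) with ht
    have ht0 : 0 < t := lt_min (by positivity) (by positivity)
    have ht1 : t * M ≤ 1 / 2 := by
      have := mul_le_mul_of_nonneg_right (min_le_left (1 / (2 * M)) (|I| / (4 * M ^ 2))) hM.le
      refine this.trans (le_of_eq ?_)
      field_simp
    have ht2 : t * (4 * M ^ 2) ≤ |I| := by
      rw [← le_div_iff₀ (by positivity)]; exact min_le_right _ _
    have h1 := key t (by rwa [abs_of_pos ht0])
    have h2 := key (-t) (by rwa [abs_neg, abs_of_pos ht0])
    have h3 : t * |I| ≤ 2 * (t * M) ^ 2 := by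
      rcases abs_cases I with ⟨h, -⟩ | ⟨h, -⟩ <;> rw [h] <;> nlinarith
    have h4 : 2 * (t * M) ^ 2 = t * (t * (4 * M ^ 2)) / 2 := by ring
    have h5 : t * (t * (4 * M ^ 2)) ≤ t * |I| := mul_le_mul_of_nonneg_left ht2 ht0.le
    have h6 : 0 < t * |I| := mul_pos ht0 hIpos
    linarith
  have hFi : ∫ x, F (shift x) ∂μ = ∫ x, F x ∂μ :=
    integral_comp_shift_iterate hinv (integrable_of_continuous hFc) 1
  have hFs : Integrable (fun x => F (shift x)) μ :=
    integrable_of_continuous (hFc.comp continuous_shift)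
  rw [← hFi, ← sub_eq_zero, ← integral_sub (integrable_of_continuous hf) hFs]
  exact hzero

/-- Invariance of a measure under the normalised transfer operator with eigenfunction `h`. -/
def IsOpInvariant (φ h : Subshift A → ℝ) (lam : ℝ) (μ : Measure (Subshift A)) : Prop :=
  ∀ f : Subshift A → ℝ, Continuous f →
    ∫ x, f x ∂μ = ∫ x, op (holeWeight φ ∅) (fun y => h y * f y) x / (lam * h x) ∂μ

theorem IsOpInvariant.integral_eq_pow (hμ : IsOpInvariant φ h lam μ) (hφ : Continuous φ)
    (hc : Continuous h) (hpos : ∀ x, 0 < h x) (hlam : 0 < lam) (n : ℕ)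
    {f : Subshift A → ℝ} (hf : Continuous f) : ∫ x, f x ∂μ =
      ∫ x, (op (holeWeight φ ∅) ^ n) (fun y => h y * f y) x / (lam ^ n * h x) ∂μ := by
  have hGc : Continuous (holeWeight φ (∅ : Set (Subshift A))) :=
    continuous_holeWeight hφ (dependsOn_empty 0)
  induction n with
  | zero =>
    refine integral_congr_ae (Eventually.of_forall fun x => ?_)
    have := (hpos x).ne'
    simp only [pow_zero, one_mul, Module.End.one_apply]
    field_simp
  | succ n ih =>
    have hcont : Continuous fun x => (op (holeWeight φ ∅) ^ n) (fun y => h y * f y) x /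
        (lam ^ n * h x) := (continuous_op_pow hGc (hc.mul hf) n).div (continuous_const.mul hc)
      fun x => (mul_pos (pow_pos hlam n) (hpos x)).ne'
    rw [ih, hμ _ hcont]
    refine integral_congr_ae (Eventually.of_forall fun x => ?_)
    have h1 : (fun y => h y * ((op (holeWeight φ ∅) ^ n) (fun y => h y * f y) y /
        (lam ^ n * h y))) = (lam ^ n)⁻¹ • (op (holeWeight φ ∅) ^ n) fun y => h y * f y := by
      funext y
      have := (hpos y).ne'
      simp only [Pi.smul_apply, smul_eq_mul]
      field_simp
    dsimp only
    rw [h1, map_smul, op_pow_succ']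
    simp only [Pi.smul_apply, smul_eq_mul]
    rw [pow_succ]
    field_simp

/-- By mixing, the `(n + d)`-th iterate applied to `h` times the indicator of the cylinder is
positive everywhere, and the measure of the cylinder is the integral of its normalisation. -/
theorem IsOpInvariant.cylinder_ne_zero [IsProbabilityMeasure μ] (hμ : IsOpInvariant φ h lam μ)
    (hφ : Continuous φ)
    (hA : ∀ i j, A i j = 0 ∨ A i j = 1) {d : ℕ} (hd : ∀ i j, 0 < (A ^ d) i j)
    (hc : Continuous h) (hpos : ∀ x, 0 < h x) (hlam : 0 < lam) (x : Subshift A) (n : ℕ) :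
    μ (cylinder x n) ≠ 0 := by
  intro h0
  have hclopen := (dependsOn_cylinder x n).isClopen
  have hG := holeWeight_nonneg φ (∅ : Set (Subshift A))
  have hf : Continuous ((cylinder x n).indicator fun _ => (1 : ℝ)) :=
    continuous_const.indicator (by simp [hclopen.frontier_eq])
  have h1 := hμ.integral_eq_pow hφ hc hpos hlam (n + d) hf
  rw [integral_indicator hclopen.isOpen.measurableSet, setIntegral_const, measureReal_def, h0] at h1
  simp only [ENNReal.toReal_zero, zero_smul] at h1
  have hF0 : 0 ≤ fun y => h y * (cylinder x n).indicator (fun _ => (1 : ℝ)) y := fun y =>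
    mul_nonneg (hpos y).le (indicator_nonneg (fun _ _ => zero_le_one) y)
  have hcont := (continuous_op_pow (continuous_holeWeight hφ (dependsOn_empty (A := A) 0))
    (hc.mul hf) (n + d)).div (continuous_const.mul hc)
    fun x => (mul_pos (pow_pos hlam (n + d)) (hpos x)).ne'
  have h2 : ∀ y, 0 < (op (holeWeight φ ∅) ^ (n + d))
      (fun y => h y * (cylinder x n).indicator (fun _ => (1 : ℝ)) y) y := fun y => by
    obtain ⟨w, hw, hwy⟩ := exists_preimage_mem_cylinder hA hd n x y
    have := le_op_pow_shift hG hF0 (n + d) w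
    rw [hwy, indicator_of_mem (show w ∈ cylinder x n from hw), mul_one] at this
    exact (mul_pos (Finset.prod_pos fun i _ => holeWeight_empty_pos φ _) (hpos w)).trans_le this
  have h3 := (integral_eq_zero_iff_of_nonneg
    (fun y => div_nonneg (h2 y).le (mul_pos (pow_pos hlam _) (hpos y)).le)
    (integrable_of_continuous hcont)).1 h1.symm
  obtain ⟨y, hy⟩ := h3.exists
  exact (div_pos (h2 y) (mul_pos (pow_pos hlam (n + d)) (hpos y))).ne' hy

/-- Almost every point has no preimage in a given null set. -/
theorem IsOpInvariant.ae_pre_notMem [IsProbabilityMeasure μ] (hμ : IsOpInvariant φ h lam μ)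
    (hφ : Continuous φ) (hc : Continuous h) (hpos : ∀ x, 0 < h x) (hlam : 0 < lam)
    {N : Set (Subshift A)} (hN : μ N = 0) :
    ∀ᵐ x ∂μ, ∀ a, A a (x.1 0) = 1 → pre a x ∉ N := by
  set G := holeWeight φ (∅ : Set (Subshift A)) with hGdef
  have hGc : Continuous G := continuous_holeWeight hφ (dependsOn_empty 0)
  let w : Fin l → Subshift A → ℝ := fun a x =>
    (if A a (x.1 0) = 1 then 1 else 0) * (G (pre a x) * h (pre a x) / (lam * h x))
  have hden : ∀ x, 0 < lam * h x := fun x => mul_pos hlam (hpos x)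
  have hwc : ∀ a, Continuous (w a) := fun a =>
    (continuous_comp_coord (fun b : Fin l => if A a b = 1 then (1 : ℝ) else 0) 0).mul
      (((hGc.comp (continuous_pre a)).mul (hc.comp (continuous_pre a))).div
        (continuous_const.mul hc) fun x => (hden x).ne')
  have hw0 : ∀ a x, 0 ≤ w a x := fun a x => by
    have h1 : 0 ≤ G (pre a x) := holeWeight_nonneg φ ∅ _
    have h2 := (hpos (pre a x)).le
    have h3 := (hden x).le
    simp only [w]
    split_ifs <;> positivity
  have hwpos : ∀ a x, A a (x.1 0) = 1 → 0 < w a x := fun a x hax => by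
    simp only [w, if_pos hax, one_mul]
    exact div_pos (mul_pos (holeWeight_empty_pos φ _) (hpos _)) (hden x)
  let D : Fin l → Measure (Subshift A) := fun a =>
    μ.withDensity fun x => ((w a x).toNNReal : ENNReal)
  have hDmeas : ∀ a, Measurable fun x => (w a x).toNNReal := fun a =>
    (hwc a).measurable.real_toNNReal
  have hDfin : ∀ a, IsFiniteMeasure (D a) := fun a => by
    refine isFiniteMeasure_withDensity ?_
    exact (integrable_of_continuous (hwc a)).lintegral_lt_top.ne
  -- Invariance on continuous functions, read as an identity of measures: `μ` is the sum of its
  -- images under the inverse branches with densities `w a`. These are positive where the branch is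
  -- admissible, so the branch cannot carry positive mass into a null set.
  have hsum : ∑ a, (D a).map (pre a) = μ := by
    have : IsFiniteMeasure (∑ a, (D a).map (pre a)) := inferInstance
    refine ext_of_forall_integral_eq_of_IsFiniteMeasure fun f => ?_
    have hfm : ∀ a, Integrable f ((D a).map (pre a)) := fun a =>
      integrable_of_continuous f.continuous
    rw [integral_finsetSum_measure fun a _ => hfm a, hμ f f.continuous]
    have h1 : ∀ a, ∫ x, f x ∂((D a).map (pre a)) = ∫ x, w a x * f (pre a x) ∂μ := fun a => by
      rw [integral_map (continuous_pre a).measurable.aemeasurable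
        f.continuous.aestronglyMeasurable, integral_withDensity_eq_integral_smul (hDmeas a)]
      refine integral_congr_ae (Eventually.of_forall fun x => ?_)
      simp only [NNReal.smul_def, Real.coe_toNNReal _ (hw0 a x), smul_eq_mul]
    have h2 : ∀ a, Integrable (fun x => w a x * f (pre a x)) μ := fun a =>
      integrable_of_continuous ((hwc a).mul (f.continuous.comp (continuous_pre a)))
    rw [Finset.sum_congr rfl fun a _ => h1 a, ← integral_finsetSum _ fun a _ => h2 a]
    refine integral_congr_ae (Eventually.of_forall fun x => ?_)
    simp only [op_apply, Finset.sum_div, w]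
    refine Finset.sum_congr rfl fun a _ => ?_
    split_ifs
    · ring
    · simp
  rw [ae_all_iff]
  intro a
  have h1 : (D a).map (pre a) N = 0 := by
    refine nonpos_iff_eq_zero.1 ?_
    rw [← hN]
    conv_rhs => rw [← hsum]
    rw [Measure.finsetSum_apply]
    exact Finset.single_le_sum (f := fun a => (D a).map (pre a) N) (fun _ _ => zero_le)
      (Finset.mem_univ a)
  have h2 : D a (pre a ⁻¹' N) = 0 :=
    (⟨(continuous_pre a).measurable, Measure.AbsolutelyContinuous.rfl⟩ :
      Measure.QuasiMeasurePreserving (pre a) (D a) ((D a).map (pre a))).preimage_null h1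
  have h3 := (withDensity_apply_eq_zero (hDmeas a).coe_nnreal_ennreal).1 h2
  filter_upwards [measure_eq_zero_iff_ae_notMem.1 h3] with x hx hax hxN
  refine hx ⟨?_, hxN⟩
  simpa using hwpos a x hax

end Equilibrium

/-! ### The growth rate as leading eigenvalue on `B_θ` -/

section Eigenvalues

variable {l : ℕ} {A : Matrix (Fin l) (Fin l) ℕ} {φ h : Subshift A → ℝ} {lam : ℝ}
  {μ : Measure (Subshift A)} {θ : ℝ} {V : Set (Subshift A)}

theorem IsThetaLipschitz.exists_agreeHolder (hθ : 0 < θ) (hθ' : θ < 1)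
    (hφ : IsThetaLipschitz θ φ) : ∃ C, 0 ≤ C ∧ IsAgreeHolder θ C φ := by
  obtain ⟨C, hC⟩ := hφ
  refine ⟨max C 0, le_max_right _ _, fun m x y hxy => (hC x y).trans ?_⟩
  have h0 : 0 ≤ dTheta θ x y := by
    rw [dTheta]; split_ifs <;> positivity
  have h1 : dTheta θ x y ≤ θ ^ m := by
    rw [dTheta]
    split_ifs with hne
    · positivity
    · refine pow_le_pow_of_le_one hθ.le hθ'.le ?_
      by_contra! hlt
      exact PiNat.apply_firstDiff_ne (fun h => hne (Subtype.ext h)) (hxy _ hlt)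
  exact mul_le_mul (le_max_left _ _) h1 h0 (le_max_right _ _)

/-- For `m ≥ q` the inequality `e^t - 1 ≤ t e^t` turns the multiplicative bound into an additive
one; for `m < q` the supremum `M` is itself at most `M θ^(-q) θ^m`. -/
theorem LogHolder.exists_agreeHolder {B : ℝ} {q : ℕ} (hθ : 0 < θ) (hθ' : θ < 1) (hB : 0 ≤ B)
    (hh : LogHolder θ B q h) : ∃ D, 0 ≤ D ∧ IsAgreeHolder θ D h := by
  obtain ⟨M, hM, hhM⟩ := exists_bound (hh.continuous hθ hθ')
  have hhM' : ∀ x, h x ≤ M := fun x => (le_abs_self _).trans (hhM x)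
  refine ⟨max (B * Real.exp B * M) (M * (θ ^ q)⁻¹), le_max_of_le_left (by positivity),
    fun m x y hxy => ?_⟩
  have hθm : 0 < θ ^ m := by positivity
  rcases le_or_gt q m with hqm | hqm
  · have key : ∀ x y, Agree m x y → h x - h y ≤ B * Real.exp B * M * θ ^ m := by
      intro x y hxy
      set t := B * θ ^ m with ht
      have ht0 : 0 ≤ t := by positivity
      have htB : t ≤ B := mul_le_of_le_one_right hB (pow_le_one₀ hθ.le hθ'.le)
      have h1 := hh.le_mul m hqm x y hxy
      have h2 : Real.exp t - 1 ≤ t * Real.exp t := by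
        have h3 := Real.add_one_le_exp (-t)
        have h4 := mul_le_mul_of_nonneg_right h3 (Real.exp_nonneg t)
        rw [← Real.exp_add, neg_add_cancel, Real.exp_zero] at h4
        linarith
      have h5 : t * Real.exp t ≤ t * Real.exp B :=
        mul_le_mul_of_nonneg_left (Real.exp_le_exp.2 htB) ht0
      have h6 : (Real.exp t - 1) * h y ≤ t * Real.exp B * M :=
        (mul_le_mul_of_nonneg_right (h2.trans h5) (hh.nonneg y)).trans
          (mul_le_mul_of_nonneg_left (hhM' y) (by positivity))
      have h7 : t * Real.exp B * M = B * Real.exp B * M * θ ^ m := by rw [ht]; ring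
      linarith
    refine le_trans ?_ (mul_le_mul_of_nonneg_right (le_max_left _ _) hθm.le)
    rw [abs_le]
    constructor
    · linarith [key y x hxy.symm]
    · exact key x y hxy
  · refine le_trans ?_ (mul_le_mul_of_nonneg_right (le_max_right _ _) hθm.le)
    have h1 : M ≤ M * (θ ^ q)⁻¹ * θ ^ m := by
      rw [mul_assoc]
      refine le_mul_of_one_le_right hM.le ?_
      rw [one_le_inv_mul₀ (by positivity)]
      exact pow_le_pow_of_le_one hθ.le hθ'.le hqm.le
    refine le_trans ?_ h1
    rw [abs_le]
    have := hh.nonneg x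
    have := hh.nonneg y
    simp only [Pi.zero_apply] at *
    constructor
    · linarith [hhM' y]
    · linarith [hhM' x]

theorem osc_le_of_agreeHolder [IsProbabilityMeasure μ] {D : ℝ} (hD : IsAgreeHolder θ D h) (m : ℕ)
    (x : Subshift A) : osc μ (fun y => (h y : ℂ)) m x ≤ ENNReal.ofReal (D * θ ^ m) := by
  refine essSup_le_of_ae_le _ ?_
  rw [Measure.prod_restrict]
  have hS := (isOpen_cylinder x m).measurableSet
  filter_upwards [ae_restrict_mem (hS.prod hS)] with p hp
  rw [← Complex.ofReal_sub, ← ofReal_norm, Complex.norm_real]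
  exact ENNReal.ofReal_le_ofReal (hD m _ _ (Agree.trans hp.1 (Agree.symm hp.2)))

theorem memB_of_agreeHolder [IsProbabilityMeasure μ] (hθ : 0 < θ) (hθ' : θ < 1) {D : ℝ}
    (hD : IsAgreeHolder θ D h) : MemB θ μ (fun y => (h y : ℂ)) := by
  refine ⟨(integrable_of_continuous (hD.continuous hθ hθ')).ofReal, ?_⟩
  refine lt_of_le_of_lt (iSup_le fun m => iSup_le fun _ => ?_)
    (ENNReal.ofReal_lt_top (r := D))
  have hθm : 0 < θ ^ m := by positivity
  have h1 : ∫⁻ x, osc μ (fun y => (h y : ℂ)) m x ∂μ ≤ ENNReal.ofReal (D * θ ^ m) := by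
    refine (lintegral_mono fun x => osc_le_of_agreeHolder hD m x).trans ?_
    simp
  refine (mul_le_mul_right h1 _).trans ?_
  rw [← ENNReal.ofReal_mul (by positivity)]
  refine ENNReal.ofReal_le_ofReal (le_of_eq ?_)
  field_simp

/-- Functions in `B_θ` are essentially bounded. -/
theorem MemB.exists_ae_bound [IsProbabilityMeasure μ] {w : Subshift A → ℂ} (hθ : 0 < θ)
    (hw : MemB θ μ w) : ∃ M : ℝ, 0 < M ∧ ∀ᵐ x ∂μ, ‖w x‖ ≤ M := by
  have h1 : ∫⁻ x, osc μ w 1 x ∂μ < ⊤ := by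
    have h2 : ENNReal.ofReal ((θ ^ 1)⁻¹) * ∫⁻ x, osc μ w 1 x ∂μ < ⊤ :=
      lt_of_le_of_lt (le_iSup₂ (f := fun m (_ : 1 ≤ m) =>
        ENNReal.ofReal ((θ ^ m)⁻¹) * ∫⁻ x, osc μ w m x ∂μ) 1 le_rfl) hw.2
    by_contra htop
    rw [not_lt, top_le_iff] at htop
    rw [htop, ENNReal.mul_top (by simpa using hθ)] at h2
    exact lt_irrefl _ h2
  have hcyl : ∀ a : Fin l, MeasurableSet {x : Subshift A | x.1 0 = a} := fun a =>
    (continuous_coord 0).measurable (measurableSet_singleton a)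
  have key : ∀ a : Fin l, ∃ M : ℝ, 0 < M ∧ ∀ᵐ x ∂μ, x.1 0 = a → ‖w x‖ ≤ M := by
    intro a
    by_cases h0 : μ {x : Subshift A | x.1 0 = a} = 0
    · refine ⟨1, one_pos, ?_⟩
      filter_upwards [measure_eq_zero_iff_ae_notMem.1 h0] with x hx hxa
      exact absurd hxa hx
    -- The oscillation is integrable, so it is finite at some point of a cylinder of positive
    -- measure. Fubini then fixes one value `w y` from which almost all others in the cylinder are
    -- within that oscillation.
    · obtain ⟨x0, hx0, hfin⟩ : ∃ x0 : Subshift A, x0.1 0 = a ∧ osc μ w 1 x0 ≠ ⊤ := by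
        by_contra! hcon
        have h2 : ∫⁻ x in {x : Subshift A | x.1 0 = a}, osc μ w 1 x ∂μ = ⊤ := by
          rw [setLIntegral_congr_fun (hcyl a) (g := fun _ => ⊤) fun x hx => hcon x hx]
          rw [setLIntegral_const]
          exact ENNReal.top_mul h0
        exact h1.ne (top_le_iff.1 (h2 ▸ setLIntegral_le_lintegral _ _))
      have hS : cylinder x0 1 = {x : Subshift A | x.1 0 = a} := by
        ext x
        constructor
        · intro hx; exact (hx 0 Nat.one_pos).trans hx0
        · intro hx i hi
          obtain rfl : i = 0 := by omega
          exact (show x.1 0 = a from hx).trans hx0.symm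
      have h3 : ∀ᵐ p ∂((μ.restrict (cylinder x0 1)).prod (μ.restrict (cylinder x0 1))),
          ‖w p.1 - w p.2‖ₑ ≤ osc μ w 1 x0 := ae_le_essSup
      rw [hS] at h3
      have h4 := Measure.ae_ae_of_ae_prod h3
      have hne : (ae (μ.restrict {x : Subshift A | x.1 0 = a})).NeBot := by
        rw [ae_neBot, Ne, Measure.restrict_eq_zero]
        exact h0
      obtain ⟨y, hy⟩ := h4.exists
      refine ⟨(osc μ w 1 x0).toReal + ‖w y‖ + 1, by positivity, ?_⟩
      filter_upwards [(ae_restrict_iff' (hcyl a)).1 hy] with x hx hxa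
      have h5 := hx hxa
      have h6 : ‖w y - w x‖ ≤ (osc μ w 1 x0).toReal := by
        rw [← toReal_enorm]
        exact ENNReal.toReal_mono hfin h5
      have h7 := norm_sub_norm_le (w x) (w y)
      rw [norm_sub_rev] at h7
      linarith
  choose M hM hMw using key
  refine ⟨∑ a, M a + 1, add_pos_of_nonneg_of_pos (Finset.sum_nonneg fun a _ => (hM a).le) one_pos,
    ?_⟩
  filter_upwards [ae_all_iff.2 hMw] with x hx
  have h1 := Finset.single_le_sum (fun a _ => (hM a).le) (Finset.mem_univ (x.1 0))
  linarith [hx (x.1 0) rfl]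

theorem punctured_apply (φ : Subshift A → ℝ) (V : Set (Subshift A)) (w : Subshift A → ℂ)
    (x : Subshift A) : punctured φ V w x =
      ∑ a, if A a (x.1 0) = 1 then (holeWeight φ V (pre a x) : ℂ) * w (pre a x) else 0 := by
  rw [punctured, transfer, sum_fibre (fun y => (Real.exp (φ y) : ℂ) * Vᶜ.indicator w y)]
  refine Finset.sum_congr rfl fun a _ => ?_
  congr 1
  by_cases hx : pre a x ∈ V <;> simp [holeWeight, hx]

theorem punctured_empty (φ : Subshift A → ℝ) : punctured φ ∅ = transfer φ := by
  funext w
  simp [punctured]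

theorem punctured_ofReal (φ : Subshift A → ℝ) (V : Set (Subshift A)) (f : Subshift A → ℝ)
    (x : Subshift A) :
    punctured φ V (fun y => (f y : ℂ)) x = ((op (holeWeight φ V) f x : ℝ) : ℂ) := by
  rw [punctured_apply, op_apply]
  push_cast
  refine Finset.sum_congr rfl fun a _ => ?_
  split_ifs <;> push_cast <;> rfl

theorem norm_punctured_le (φ : Subshift A → ℝ) (V : Set (Subshift A)) (w : Subshift A → ℂ)
    (x : Subshift A) : ‖punctured φ V w x‖ ≤ op (holeWeight φ V) (fun y => ‖w y‖) x := by
  rw [punctured_apply, op_apply]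
  refine (norm_sum_le _ _).trans (Finset.sum_le_sum fun a _ => ?_)
  split_ifs
  · rw [norm_mul, Complex.norm_real, Real.norm_of_nonneg (holeWeight_nonneg φ V _)]
  · simp

/-- The points with an iterated preimage in `N`. -/
def forwardOrbit (N : Set (Subshift A)) : ℕ → Set (Subshift A)
  | 0 => N
  | k + 1 => {x | ∃ a, A a (x.1 0) = 1 ∧ pre a x ∈ forwardOrbit N k}

/-- An essentially bounded eigenfunction satisfies `|η|^k |w| ≤ M · op^k 1` almost everywhere, so at
a point where `w ≠ 0` every growth rate is at least `|η|`. -/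
theorem norm_eigenvalue_le [IsProbabilityMeasure μ] (hθ : 0 < θ)
    (hns : ∀ N : Set (Subshift A), μ N = 0 → ∀ᵐ x ∂μ, ∀ a, A a (x.1 0) = 1 → pre a x ∉ N)
    (hGc : Continuous (holeWeight φ V)) {η : ℂ} (hη : IsEigenvalueB θ μ (punctured φ V) η) :
    ‖η‖ ≤ radius (holeWeight φ V) := by
  obtain ⟨w, hw, hw0, he⟩ := hη
  obtain ⟨M, hM, hwM⟩ := hw.exists_ae_bound hθ
  have hG : 0 ≤ holeWeight φ V := holeWeight_nonneg φ V
  -- The induction evaluates the relation at all iterated preimages, so the points with an iterated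
  -- preimage in `N` must be discarded; `hns` makes them null.
  set N : Set (Subshift A) := {x | ¬ (‖w x‖ ≤ M ∧ punctured φ V w x = η * w x)}
  have hN : μ N = 0 := ae_iff.1 (hwM.and he)
  have hNk : ∀ k, μ (forwardOrbit N k) = 0 := fun k => by
    induction k with
    | zero => exact hN
    | succ k ih =>
      refine measure_mono_null (fun x hx => ?_) (ae_iff.1 (hns _ ih))
      obtain ⟨a, hax, hxN⟩ := hx
      exact fun hcon => hcon a hax hxN
  have hbound : ∀ k x, (∀ j, x ∉ forwardOrbit N j) →
      ‖η‖ ^ k * ‖w x‖ ≤ M * (op (holeWeight φ V) ^ k) 1 x := by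
    intro k
    induction k with
    | zero =>
      intro x hx
      have h1 := not_not.1 (hx 0)
      simpa using h1.1
    | succ k ih =>
      intro x hx
      have h1 := not_not.1 (hx 0)
      have h2 : ‖η‖ * ‖w x‖ ≤ op (holeWeight φ V) (fun y => ‖w y‖) x := by
        rw [← norm_mul, ← h1.2]
        exact norm_punctured_le φ V w x
      rw [pow_succ, mul_assoc]
      refine (mul_le_mul_of_nonneg_left h2 (by positivity)).trans ?_
      rw [op_pow_succ', op_apply, op_apply, Finset.mul_sum, Finset.mul_sum]
      refine Finset.sum_le_sum fun a _ => ?_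
      split_ifs with hax
      · have h3 := ih (pre a x) fun j hj => hx (j + 1) ⟨a, hax, hj⟩
        have h4 := mul_le_mul_of_nonneg_left h3 (hG (pre a x))
        linarith
      · simp
  obtain ⟨x, hx, hx0⟩ : ∃ x, (∀ j, x ∉ forwardOrbit N j) ∧ w x ≠ 0 := by
    by_contra! hcon
    refine hw0 ?_
    have h1 : ∀ᵐ x ∂μ, ∀ j, x ∉ forwardOrbit N j :=
      ae_all_iff.2 fun j => measure_eq_zero_iff_ae_notMem.1 (hNk j)
    filter_upwards [h1] with x hx
    exact hcon x hx
  refine le_csInf (growthRates_nonempty hG hGc) ?_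
  rintro s ⟨hs, C, hC, hsC⟩
  by_contra! hlt
  have hwx : 0 < ‖w x‖ := norm_pos_iff.2 hx0
  obtain ⟨k, hk⟩ := pow_unbounded_of_one_lt (M * C / ‖w x‖) ((one_lt_div hs).2 hlt)
  have h1 := (hbound k x hx).trans (mul_le_mul_of_nonneg_left (hsC k x) hM.le)
  rw [div_pow, div_lt_div_iff₀ hwx (by positivity)] at hk
  linarith

/-- The growth rate is the leading eigenvalue on `B_θ`. -/
theorem isLeadingEigenvalue_radius [IsProbabilityMeasure μ] (hθ : 0 < θ) (hθ' : θ < 1)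
    (hns : ∀ N : Set (Subshift A), μ N = 0 → ∀ᵐ x ∂μ, ∀ a, A a (x.1 0) = 1 → pre a x ∉ N)
    (hsupp : ∀ x n, μ (cylinder x n) ≠ 0) {C : ℝ} (hC : 0 ≤ C) (hφ : IsAgreeHolder θ C φ)
    {q : ℕ} (hV : DependsOn q V) (hq : 1 ≤ q) (hr : 0 < radius (holeWeight φ V)) :
    IsLeadingEigenvalue θ μ (punctured φ V) (radius (holeWeight φ V)) := by
  have hne : Nonempty (Subshift A) := μ.nonempty_of_neZero
  refine ⟨hr, ?_, fun η hη => norm_eigenvalue_le hθ hns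
    (continuous_holeWeight (hφ.continuous hθ hθ') hV) hη⟩
  set B := C * θ / (1 - θ) with hB
  have hθ1 : 0 < 1 - θ := by linarith
  have hB0 : 0 ≤ B := by positivity
  obtain ⟨h, hh, ⟨x0, hx0⟩, he⟩ := exists_eigenfunction (B := B) (hφ.logHolder hV) hq hθ hθ'
    hB0 (le_of_eq (by rw [hB]; field_simp; ring)) hr
  obtain ⟨D, -, hD⟩ := hh.exists_agreeHolder hθ hθ' hB0
  refine ⟨fun y => (h y : ℂ), memB_of_agreeHolder hθ hθ' hD, fun h0 => ?_,
    Eventually.of_forall fun x => ?_⟩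
  -- The log-Hölder bound makes `h` nonzero on the whole `q`-cylinder of `x0`, which has positive
  -- measure.
  · refine hsupp x0 q (measure_mono_null (fun x hx => ?_) (ae_iff.1 h0))
    intro hx'
    have h1 : h x = 0 := by simpa using hx'
    have h2 := hh.le_mul q le_rfl x0 x (Agree.symm hx)
    rw [h1, mul_zero] at h2
    linarith
  · rw [punctured_ofReal, he]
    simp

end Eigenvalues

/-! ### Consequences of the hole hypotheses and conclusion -/

section Main

variable {l : ℕ} {A : Matrix (Fin l) (Fin l) ℕ} {μ : Measure (Subshift A)} {z : Subshift A}
  {U : ℕ → Set (Subshift A)}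

theorem IsHoleFamily.dependsOn (hU : IsHoleFamily μ z U) {n : ℕ} (hn : 1 ≤ n) :
    DependsOn n (U n) := by
  obtain ⟨F, hF⟩ := hU.cylinders n hn
  rw [hF]
  intro x y hxy hx
  simp only [mem_iUnion] at hx ⊢
  obtain ⟨v, hv, hx⟩ := hx
  exact ⟨v, hv, dependsOn_cylinder v n x y hxy hx⟩

theorem IsHoleFamily.eventually_subset_cylinder (hU : IsHoleFamily μ z U) (Q : ℕ) :
    ∀ᶠ n in atTop, U n ⊆ cylinder z Q := by
  obtain ⟨L, κ, hκ, hL⟩ := hU.subset_cylinder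
  filter_upwards [eventually_ge_atTop 1,
    (tendsto_natCast_atTop_atTop.const_mul_atTop hκ).eventually_ge_atTop (Q : ℝ)] with n hn hQ
  obtain ⟨h1, -, h3⟩ := hL n hn
  have hn' : (0 : ℝ) < n := by exact_mod_cast hn
  rw [lt_div_iff₀ hn'] at h1
  have hQL : Q ≤ L n := by exact_mod_cast hQ.trans h1.le
  exact fun x hx => Agree.mono (h3 hx) hQL

/-- Over at most one symbol the space is the single point `z`, every hole has measure 1, and this
contradicts the decay of the measures. Two symbols are what makes a single cylinder lose mass. -/
theorem IsHoleFamily.two_le [IsProbabilityMeasure μ] (hU : IsHoleFamily μ z U) : 2 ≤ l := by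
  by_contra hl
  have hs : Subsingleton (Fin l) := Fin.subsingleton_iff_le_one.2 (by omega)
  have hz : ∀ n, 1 ≤ n → U n = univ := fun n hn => by
    have h1 : z ∈ ⋂ (n : ℕ) (_ : 1 ≤ n), U n := by rw [hU.inter_eq]; rfl
    rw [mem_iInter₂] at h1
    refine eq_univ_of_forall fun x => ?_
    rw [show x = z from Subtype.ext (funext fun i => Subsingleton.elim _ _)]
    exact h1 n hn
  obtain ⟨c, ρ, -, hρ, hρ', hm⟩ := hU.measure_le
  have hlim : Tendsto (fun n : ℕ => c * ρ ^ n) atTop (𝓝 0) := by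
    simpa using (tendsto_pow_atTop_nhds_zero_of_lt_one hρ.le hρ').const_mul c
  obtain ⟨n, hn1, hn⟩ := ((hlim.eventually (gt_mem_nhds one_pos)).and
    (eventually_ge_atTop 1)).exists
  have := hm n hn
  rw [hz n hn, probReal_univ] at this
  linarith

end Main

end EscapeRate

end

theorem mainTheorem9 {l : ℕ} (A : Matrix (Fin l) (Fin l) ℕ)
    (hA : ∀ i j, A i j = 0 ∨ A i j = 1)
    (hprim : ∃ d : ℕ, 0 < d ∧ ∀ i j, 0 < (A ^ d) i j)
    (θ : ℝ) (hθ : 0 < θ) (hθ' : θ < 1)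
    (φ : EscapeRate.Subshift A → ℝ) (hφ : EscapeRate.IsThetaLipschitz θ φ)
    (μ : Measure (EscapeRate.Subshift A)) (hμ : EscapeRate.IsEquilibriumState φ μ)
    (z : EscapeRate.Subshift A) (U : ℕ → Set (EscapeRate.Subshift A))
    (hU : EscapeRate.IsHoleFamily μ z U) :
    ∃ (lam : ℝ) (lamn : ℕ → ℝ),
      EscapeRate.IsLeadingEigenvalue θ μ (EscapeRate.transfer φ) lam ∧
      (∀ᶠ n in atTop,
        EscapeRate.IsLeadingEigenvalue θ μ (EscapeRate.punctured φ (U n)) (lamn n)) ∧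
      Tendsto lamn atTop (𝓝 lam) ∧
      EscapeRate.pressure φ univ = ((Real.log lam : ℝ) : EReal) ∧
      (∀ᶠ n in atTop, EscapeRate.pressure φ (EscapeRate.survivor (U n)) =
        ((Real.log (lamn n) : ℝ) : EReal)) ∧
      Tendsto (fun n => EscapeRate.pressure φ (EscapeRate.survivor (U n))) atTop
        (𝓝 (EscapeRate.pressure φ univ)) := by
  open EscapeRate in
  obtain ⟨d, hd0, hd⟩ := hprim
  have hne : Nonempty (Subshift A) := ⟨z⟩
  have := hμ.prob
  obtain ⟨C, hC, hφC⟩ := hφ.exists_agreeHolder hθ hθ'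
  have hφc := hφC.continuous hθ hθ'
  have hdep : DependsOn 1 (∅ : Set (Subshift A)) := dependsOn_empty 1
  set lam := radius (holeWeight φ (∅ : Set (Subshift A))) with hlamdef
  have hlam : 0 < lam := radius_empty_pos hφc (exists_preimage hA hd0 hd)
  have hsurv : survivor (∅ : Set (Subshift A)) = univ := by simp [survivor]
  have hP : pressure φ univ = ((Real.log lam : ℝ) : EReal) := by
    rw [← hsurv]
    exact pressure_survivor_eq hθ hθ' hC hφC hdep le_rfl hlam
  have hθ1 : 0 < 1 - θ := by linarith
  obtain ⟨h, hh, ⟨x0, hx0⟩, he⟩ := exists_eigenfunction (B := C * θ / (1 - θ))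
    (hφC.logHolder hdep) le_rfl hθ hθ' (by positivity)
    (le_of_eq (by field_simp; ring)) hlam
  have hpos := eigenfunction_pos hA hd hh hx0 hlam he
  have hc := hh.continuous hθ hθ'
  have hinv : IsOpInvariant φ h lam μ := fun f hf =>
    integral_eq_integral_op hφc hμ.invariant (hμ.attains.trans hP) hc hpos hlam he hf
  have hns := fun N (hN : μ N = 0) => hinv.ae_pre_notMem hφc hc hpos hlam hN
  have hsupp := hinv.cylinder_ne_zero hφc hA hd hc hpos hlam
  have hlim : Tendsto (fun n => radius (holeWeight φ (U n))) atTop (𝓝 lam) := by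
    refine tendsto_order.2 ⟨fun a ha => ?_, fun b hb => Eventually.of_forall fun n => ?_⟩
    -- An intermediate `s`, because the small-hole bound is not strict and requires a nonnegative
    -- threshold.
    · obtain ⟨s, hs1, hs2⟩ := exists_between (max_lt ha hlam)
      obtain ⟨Q, hQ⟩ := eventually_lt_radius hA hU.two_le hd0 hd hφc hc hpos hlam he z
        ((le_max_right a 0).trans hs1.le) hs2
      filter_upwards [eventually_ge_atTop 1, hU.eventually_subset_cylinder Q] with n hn hn'
      exact ((le_max_left a 0).trans_lt hs1).trans_le (hQ _ n (hU.dependsOn hn) hn')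
    · refine (radius_mono (holeWeight_nonneg φ _) (fun x => ?_)
        (continuous_holeWeight hφc hdep)).trans_lt hb
      rw [holeWeight_empty]
      exact indicator_le_self' (fun _ _ => Real.exp_nonneg _) x
  have hev : ∀ᶠ n in atTop, 1 ≤ n ∧ 0 < radius (holeWeight φ (U n)) :=
    (eventually_ge_atTop 1).and (hlim.eventually (lt_mem_nhds hlam))
  have hPn : ∀ᶠ n in atTop, pressure φ (survivor (U n)) =
      ((Real.log (radius (holeWeight φ (U n))) : ℝ) : EReal) := by
    filter_upwards [hev] with n hn
    exact pressure_survivor_eq hθ hθ' hC hφC (hU.dependsOn hn.1) hn.1 hn.2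
  refine ⟨lam, fun n => radius (holeWeight φ (U n)), ?_, ?_, hlim, hP, hPn, ?_⟩
  · rw [← punctured_empty]
    exact isLeadingEigenvalue_radius hθ hθ' hns hsupp hC hφC hdep le_rfl hlam
  · filter_upwards [hev] with n hn
    exact isLeadingEigenvalue_radius hθ hθ' hns hsupp hC hφC (hU.dependsOn hn.1) hn.1 hn.2
  · rw [hP]
    refine Tendsto.congr' (hPn.mono fun n hn => hn.symm) ?_
    exact (continuous_coe_real_ereal.tendsto _).comp
      ((Real.continuousAt_log hlam.ne').tendsto.comp hlim)
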